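/- Let $\Omega\subset\mathbb R^d$ be a compact convex set with nonempty interior, let $\alpha>0$, and let $\mu:[0,1]\times\Omega\to(0,\infty)$ be continuous with $\partial_t\mu$ continuous on $[0,1]\times\Omega$. For a continuous positive $\rho$ on $\Omega$ let $L_\rho=-\nabla\cdot(\rho\nabla)$ with the zero flux condition on $\partial\Omega$: for $g\in L^2(\Omega)$, $u=(L_\rho+\alpha I)^{-1}g$ means that $u\in H^1(\Omega)$ and $\int_\Omega \rho\nabla u\cdot\nabla\varphi\,dx=\int_\Omega (g-\alpha u)\varphi\,dx$ for all $\varphi\in H^1(\Omega)$. Put $$\mathcal I(\mu)=\int_0^1\int_\Omega \partial_t\mu\,(L_\mu+\alpha I)^{-1}\partial_t\mu\,dx\,dt .$$ Then, for every $t\in[0,1]$, $\Phi(t,\cdot)=(L_{\mu(t,\cdot)}+\alpha I)^{-1}\partial_t\mu(t,\cdot)$ exists and is unique almost everywhere, $\mathcal I(\mu)=\int_0^1\int_\Omega\partial_t\mu\,\Phi\,dx\,dt$ is finite (the inner integral is integrable in $t$), and for every $\eta\in C^\infty([0,1]\times\Omega)$ $$\frac{d}{dh}\Big|_{h=0}\mathcal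 I(\mu+h\eta)=\int_0^1\int_\Omega\big(2\Phi\,\partial_t\eta-\|\nabla\Phi\|^2\eta\big)\,dx\,dt .$$ Consider the Euler–Lagrange equation of the problem of minimizing $\mathcal I$ over paths with given $\mu(0,\cdot)$, $\mu(1,\cdot)$, i.e. $\frac{d}{dh}\big|_{h=0}\mathcal I(\mu+h\eta)=0$ for all $\eta\in C^\infty([0,1]\times\Omega)$ with $\eta(0,\cdot)=\eta(1,\cdot)=0$. It is equivalent to the Hamilton–Jacobi equation $$\partial_t\Phi+\tfrac12\|\nabla\Phi\|^2=0 ,$$ in the following senses. (a) It always holds if and only if the Hamilton–Jacobi equation holds in the sense of distributions on $(0,1)\times\operatorname{int}\Omega$. (b) If (a representative of) $\Phi$ is $C^1$ on $(0,1)\times\operatorname{int}\Omega$, it holds if and only if the Hamilton–Jacobi equation holds at every point of $(0,1)\times\operatorname{int}\Omega$. (c) If $\Phi$ is $C^1$ on $[0,1]\times\Omega$, then $$\frac{d}{dh}\Big|_{h=0}\mathcal I(\mu+h\eta)=-\int_0^1\int_\Omega\eta\,\big(2\partial_t\Phi+\|\nabla\Phi\|^2\big)\,dx\,dt$$ for all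 such $\eta$ vanishing at $t=0,1$, and the Euler–Lagrange equation holds if and only if the Hamilton–Jacobi equation holds at every point of $[0,1]\times\Omega$ (one-sided derivatives at the boundary). -/

import Mathlib

open MeasureTheory Set Filter Topology
open scoped ContDiff

noncomputable section

/-- `u` belongs to the Sobolev space `H¹(Ω)` and `G` is its weak gradient. -/
structure IsH1 {d : ℕ} (Ω : Set (EuclideanSpace ℝ (Fin d)))
    (u : EuclideanSpace ℝ (Fin d) → ℝ)
    (G : EuclideanSpace ℝ (Fin d) → EuclideanSpace ℝ (Fin d)) : Prop where
  memLp : MemLp u 2 (volume.restrict Ω)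
  memLp_grad : MemLp G 2 (volume.restrict Ω)
  integral_eq : ∀ ψ : EuclideanSpace ℝ (Fin d) → ℝ, ContDiff ℝ ∞ ψ → HasCompactSupport ψ →
    tsupport ψ ⊆ interior Ω → ∀ v : EuclideanSpace ℝ (Fin d),
      ∫ x in Ω, u x * fderiv ℝ ψ x v = -∫ x in Ω, inner ℝ (G x) v * ψ x

open Classical in
/-- The weak gradient `∇u` on `Ω` (unique almost everywhere for `u ∈ H¹(Ω)`; `0` otherwise). -/
def weakGradient {d : ℕ} (Ω : Set (EuclideanSpace ℝ (Fin d)))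
    (u : EuclideanSpace ℝ (Fin d) → ℝ) : EuclideanSpace ℝ (Fin d) → EuclideanSpace ℝ (Fin d) :=
  if h : ∃ G, IsH1 Ω u G then h.choose else 0

/-- `L_ρ u = f`, where `L_ρ = -∇·(ρ∇)` is the weighted Laplacian on `Ω` with the zero flux
condition `ρ ∇u · n = 0` on `∂Ω`, in the weak sense: `u ∈ H¹(Ω)`, `f ∈ L²(Ω)` and
`∫ ρ ∇u·∇φ = ∫ f φ` for every `φ ∈ H¹(Ω)`. -/
def IsWeightedLaplacian {d : ℕ} (Ω : Set (EuclideanSpace ℝ (Fin d)))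
    (ρ u f : EuclideanSpace ℝ (Fin d) → ℝ) : Prop :=
  MemLp f 2 (volume.restrict Ω) ∧ ∃ G, IsH1 Ω u G ∧ ∀ φ H, IsH1 Ω φ H →
    ∫ x in Ω, ρ x * inner ℝ (G x) (H x) = ∫ x in Ω, f x * φ x

/-- `u = (L_ρ + α I)⁻¹ g`, that is, `L_ρ u = g - α u`. -/
def IsResolvent {d : ℕ} (Ω : Set (EuclideanSpace ℝ (Fin d))) (α : ℝ)
    (ρ g u : EuclideanSpace ℝ (Fin d) → ℝ) : Prop :=
  IsWeightedLaplacian Ω ρ u (fun x => g x - α * u x)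

open Classical in
/-- A representative of `(L_ρ + α I)⁻¹ g` (`0` if there is none). -/
def ellipticResolvent {d : ℕ} (Ω : Set (EuclideanSpace ℝ (Fin d))) (α : ℝ)
    (ρ g : EuclideanSpace ℝ (Fin d) → ℝ) : EuclideanSpace ℝ (Fin d) → ℝ :=
  if h : ∃ u, IsResolvent Ω α ρ g u then h.choose else 0

/-- The time derivative `∂ₜμ(t, x)` on `[0, 1]` (one-sided at the end points). -/
def timeDeriv {d : ℕ} (μ : ℝ → EuclideanSpace ℝ (Fin d) → ℝ) (t : ℝ)
    (x : EuclideanSpace ℝ (Fin d)) : ℝ :=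
  derivWithin (fun s => μ s x) (Icc 0 1) t

/-- A strictly positive density path on `[0, 1] × Ω`, continuous together with `∂ₜμ`. -/
structure IsPositivePath {d : ℕ} (Ω : Set (EuclideanSpace ℝ (Fin d)))
    (μ : ℝ → EuclideanSpace ℝ (Fin d) → ℝ) : Prop where
  pos : ∀ t ∈ Icc (0 : ℝ) 1, ∀ x ∈ Ω, 0 < μ t x
  continuousOn : ContinuousOn (fun p : ℝ × EuclideanSpace ℝ (Fin d) => μ p.1 p.2)
    (Icc 0 1 ×ˢ Ω)
  differentiable : ∀ t ∈ Icc (0 : ℝ) 1, ∀ x ∈ Ω,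
    DifferentiableWithinAt ℝ (fun s => μ s x) (Icc 0 1) t
  continuousOn_timeDeriv :
    ContinuousOn (fun p : ℝ × EuclideanSpace ℝ (Fin d) => timeDeriv μ p.1 p.2) (Icc 0 1 ×ˢ Ω)

/-- The functional `I(μ) = ∫₀¹ ∫_Ω ∂ₜμ (L_μ + α I)⁻¹ ∂ₜμ dx dt`. -/
def energy {d : ℕ} (Ω : Set (EuclideanSpace ℝ (Fin d))) (α : ℝ)
    (μ : ℝ → EuclideanSpace ℝ (Fin d) → ℝ) : ℝ :=
  ∫ t in (0 : ℝ)..1, ∫ x in Ω,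
    timeDeriv μ t x * ellipticResolvent Ω α (μ t) (timeDeriv μ t) x

/-- A smooth perturbation `η ∈ C^∞([0, 1] × Ω)`. -/
def IsPerturbation {d : ℕ} (Ω : Set (EuclideanSpace ℝ (Fin d)))
    (η : ℝ → EuclideanSpace ℝ (Fin d) → ℝ) : Prop :=
  ContDiffOn ℝ ∞ (fun p : ℝ × EuclideanSpace ℝ (Fin d) => η p.1 p.2) (Icc 0 1 ×ˢ Ω)

/-- `η` leaves the end points `μ(0, ·)` and `μ(1, ·)` of a path fixed. -/
def FixesEndpoints {d : ℕ} (Ω : Set (EuclideanSpace ℝ (Fin d)))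
    (η : ℝ → EuclideanSpace ℝ (Fin d) → ℝ) : Prop :=
  ∀ x ∈ Ω, η 0 x = 0 ∧ η 1 x = 0

/-- The functional `I` has at `μ` the directional derivative `D` in the direction `η`. -/
def HasFirstVariation {d : ℕ} (Ω : Set (EuclideanSpace ℝ (Fin d))) (α : ℝ)
    (μ η : ℝ → EuclideanSpace ℝ (Fin d) → ℝ) (D : ℝ) : Prop :=
  HasDerivAt (fun h : ℝ => energy Ω α (fun t x => μ t x + h * η t x)) D 0

/-- The Euler–Lagrange equation of the problem of minimizing `I` among the paths with given
`μ(0, ·)` and `μ(1, ·)`: the first variation vanishes in every direction that fixes the ends. -/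
def EulerLagrange {d : ℕ} (Ω : Set (EuclideanSpace ℝ (Fin d))) (α : ℝ)
    (μ : ℝ → EuclideanSpace ℝ (Fin d) → ℝ) : Prop :=
  ∀ η, IsPerturbation Ω η → FixesEndpoints Ω η → HasFirstVariation Ω α μ η 0

/-- `∂ₜΦ + ½ ‖∇Φ‖² = 0` in the sense of distributions on `(0, 1) × int Ω`. -/
def WeakHamiltonJacobi {d : ℕ} (Ω : Set (EuclideanSpace ℝ (Fin d)))
    (Φ : ℝ → EuclideanSpace ℝ (Fin d) → ℝ) : Prop :=
  ∀ ψ : ℝ → EuclideanSpace ℝ (Fin d) → ℝ,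
    ContDiff ℝ ∞ (fun p : ℝ × EuclideanSpace ℝ (Fin d) => ψ p.1 p.2) →
    HasCompactSupport (fun p : ℝ × EuclideanSpace ℝ (Fin d) => ψ p.1 p.2) →
    tsupport (fun p : ℝ × EuclideanSpace ℝ (Fin d) => ψ p.1 p.2) ⊆ Ioo 0 1 ×ˢ interior Ω →
    ∫ t in (0 : ℝ)..1, ∫ x in Ω, Φ t x * timeDeriv ψ t x =
      ∫ t in (0 : ℝ)..1, ∫ x in Ω, (1 / 2) * ‖weakGradient Ω (Φ t) x‖ ^ 2 * ψ t x

end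

/-! At each time the inner integral of the functional is a quadratic quantity `⟪k, A⁻¹ k⟫` in the
Hilbert space `H¹(Ω)`. Here `A` represents the form `∫ μ ∇p·∇q + α ∫ p q`, and `k` represents
integration against `∂ₜμ`. By compactness `μ` has a positive lower bound, so `A` is symmetric and
coercive, uniformly in time, and `Φ = A⁻¹ k` exists and is unique.

The operator is affine in `μ` and `k` is linear. A perturbation therefore replaces `(A, k)` by `(A +
h B, k + h k')`, and with `q` the perturbed solution an exact identity holds: the change of the
quadratic quantity minus `h (2⟪k', p⟫ - ⟪B p, p⟫)` is `⟪(A + h B)(q - p), q - p⟫`. Since `(A + h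
B)(q - p) = h (k' - B p)`, coercivity makes this `O(h²)` uniformly in time
(`abs_inner_sub_le_of_coercive`). Integration in time gives the first variation without
differentiating the inverse. The curve `t ↦ p t` is continuous into `H¹(Ω)` by the same coercivity,
so every inner integral is continuous in `t`; no joint measurability of `Φ` is needed.

The Euler–Lagrange equation thus says that `∫∫ (2Φ ∂ₜη - ‖∇Φ‖² η) = 0` for the admissible `η`. Test
functions are admissible, which gives the weak Hamilton–Jacobi equation. Conversely, an admissible
`η` vanishes at `t = 0, 1` but not near `∂Ω`, and `exists_testFunction_approx` approximates it by
cut-offs. The spatial cut-off costs nothing, because no spatial derivative of `η` occurs. The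
derivative of the time cut-off, of size `N` near the ends, is compensated by `|η| ≤ M' min(t, 1 -
t)`.

If `Φ` is `C¹` in the interior, its weak gradient is the classical one, and integration by parts
together with the fundamental lemma of the calculus of variations makes the weak equation pointwise.
If `Φ` is `C¹` up to the boundary, integration by parts in time gives the last formula, and
continuity carries the equation to the closure. -/

noncomputable section

/-! ### Coercive operators on a Hilbert space. -/

section Coercive

variable {V : Type*} [NormedAddCommGroup V] [InnerProductSpace ℝ V]

lemma norm_le_of_coercive {A : V →L[ℝ] V} {c : ℝ} (h : ∀ x, c * ‖x‖ ^ 2 ≤ inner ℝ (A x) x)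
    (x : V) : c * ‖x‖ ≤ ‖A x‖ := by
  rcases eq_or_ne x 0 with rfl | hx
  · simp
  · have h1 := (h x).trans (real_inner_le_norm _ _)
    have h2 : 0 < ‖x‖ := norm_pos_iff.2 hx
    exact le_of_mul_le_mul_right (by nlinarith) h2

/-- This is the Lax–Milgram theorem. -/
lemma exists_eq_of_coercive [CompleteSpace V] {A : V →L[ℝ] V} {c : ℝ} (hc : 0 < c)
    (h : ∀ x, c * ‖x‖ ^ 2 ≤ inner ℝ (A x) x) (k : V) : ∃ p, A p = k := by
  have hu := ContinuousLinearMap.isUnit_of_forall_le_norm_inner_map A (c := ⟨c, hc.le⟩) hc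
    (fun x => by
      have h1 := (h x).trans (le_abs_self _)
      rw [mul_comm]
      exact h1)
  exact (ContinuousLinearMap.isUnit_iff_bijective.1 hu).2 k

/-- The quadratic functional `⟪k, A⁻¹ k⟫` along a line `(A + h B, k + h k')`: the error of the first
order expansion is at most `h² ‖k' - B p‖² / c`. -/
lemma abs_inner_sub_le_of_coercive {A B : V →L[ℝ] V} {c h : ℝ} (hc : 0 < c)
    (hcoer : ∀ x, c * ‖x‖ ^ 2 ≤ inner ℝ ((A + h • B) x) x)
    (hsymm : ∀ x y, inner ℝ ((A + h • B) x) y = inner ℝ x ((A + h • B) y))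
    {k k' p q : V} (hp : A p = k) (hq : (A + h • B) q = k + h • k') :
    |inner ℝ (k + h • k') q - inner ℝ k p - h * (2 * inner ℝ k' p - inner ℝ (B p) p)| ≤
      h ^ 2 / c * ‖k' - B p‖ ^ 2 := by
  set T := A + h • B with hT
  have hTp : T p = k + h • B p := by simp [hT, hp]
  have hTe : T (q - p) = h • (k' - B p) := by
    rw [map_sub, hq, hTp, smul_sub]; abel
  -- The remainder is exactly the quadratic form of `T` at `q - p`. Symmetry of `T` is used to turn
  -- `⟪T p, q⟫` into `⟪k + h k', p⟫`.
  have key : inner ℝ (k + h • k') q - inner ℝ k p - h * (2 * inner ℝ k' p - inner ℝ (B p) p) =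
      inner ℝ (T (q - p)) (q - p) := by
    have e1 : inner ℝ (T p) q = inner ℝ (k + h • k') p := by
      rw [hsymm, hq, real_inner_comm]
    rw [map_sub, inner_sub_left, inner_sub_right, inner_sub_right, e1, hq, hTp]
    simp only [inner_add_left, inner_smul_left, conj_trivial]
    ring
  rw [key]
  have h1 : c * ‖q - p‖ ≤ |h| * ‖k' - B p‖ := by
    have := norm_le_of_coercive hcoer (q - p)
    rwa [hTe, norm_smul, Real.norm_eq_abs] at this
  calc |inner ℝ (T (q - p)) (q - p)| ≤ ‖T (q - p)‖ * ‖q - p‖ := abs_real_inner_le_norm _ _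
    _ = |h| * ‖k' - B p‖ * ‖q - p‖ := by rw [hTe, norm_smul, Real.norm_eq_abs]
    _ ≤ |h| * ‖k' - B p‖ * (|h| * ‖k' - B p‖ / c) := by
        gcongr
        rw [le_div_iff₀ hc]; linarith
    _ = h ^ 2 / c * ‖k' - B p‖ ^ 2 := by rw [← sq_abs h]; ring

/-- Apply coercivity to `A t (p t - p s) = k t - A t (p s)`: the right-hand side tends to `k s - A s
(p s) = 0` as `t → s`. -/
lemma continuousOn_of_coercive {X : Type*} [TopologicalSpace X] {S : Set X} {A : X → V →L[ℝ] V}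
    {k p : X → V} {c : ℝ} (hc : 0 < c) (hA : ContinuousOn A S) (hk : ContinuousOn k S)
    (hcoer : ∀ t ∈ S, ∀ x, c * ‖x‖ ^ 2 ≤ inner ℝ (A t x) x) (hp : ∀ t ∈ S, A t (p t) = k t) :
    ContinuousOn p S := by
  intro s hs
  have hbound : ∀ t ∈ S, ‖p t - p s‖ ≤ c⁻¹ * ‖k t - A t (p s)‖ := by
    intro t ht
    rw [le_inv_mul_iff₀ hc, ← hp t ht, ← map_sub]
    exact norm_le_of_coercive (hcoer t ht) _
  have hlim : Tendsto (fun t => c⁻¹ * ‖k t - A t (p s)‖) (𝓝[S] s) (𝓝 0) := by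
    have h1 : ContinuousWithinAt (fun t => c⁻¹ * ‖k t - A t (p s)‖) S s :=
      (((hk s hs).sub ((hA s hs).clm_apply continuousWithinAt_const)).norm).const_mul _
    have h2 := h1.tendsto
    simpa [hp s hs] using h2
  refine tendsto_iff_norm_sub_tendsto_zero.2 ?_
  refine squeeze_zero' (Eventually.of_forall fun _ => norm_nonneg _) ?_ hlim
  filter_upwards [self_mem_nhdsWithin] with t ht using hbound t ht

/-- The operator `D† M(ρ) D`, linear in `ρ`. -/
def conjOp {R Y V : Type*} [NormedAddCommGroup R] [NormedSpace ℝ R]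
    [NormedAddCommGroup Y] [InnerProductSpace ℝ Y] [CompleteSpace Y]
    [NormedAddCommGroup V] [InnerProductSpace ℝ V] [CompleteSpace V]
    (D : V →L[ℝ] Y) (M : R →L[ℝ] Y →L[ℝ] Y) : R →L[ℝ] V →L[ℝ] V :=
  (ContinuousLinearMap.compL ℝ V Y V (ContinuousLinearMap.adjoint D)).comp
    (((ContinuousLinearMap.compL ℝ V Y Y).flip D).comp M)

lemma inner_conjOp {R Y V : Type*} [NormedAddCommGroup R] [NormedSpace ℝ R]
    [NormedAddCommGroup Y] [InnerProductSpace ℝ Y] [CompleteSpace Y]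
    [NormedAddCommGroup V] [InnerProductSpace ℝ V] [CompleteSpace V]
    (D : V →L[ℝ] Y) (M : R →L[ℝ] Y →L[ℝ] Y) (ρ : R) (p q : V) :
    inner ℝ (conjOp D M ρ p) q = inner ℝ (M ρ (D p)) (D q) := by
  rw [← ContinuousLinearMap.adjoint_inner_left]
  rfl

end Coercive

/-! ### The Sobolev space `H¹(Ω)` and the weak gradient. -/

section Sobolev

variable {d : ℕ} {Ω : Set (EuclideanSpace ℝ (Fin d))}
  {u u' : EuclideanSpace ℝ (Fin d) → ℝ} {G G' : EuclideanSpace ℝ (Fin d) → EuclideanSpace ℝ (Fin d)}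

lemma IsH1.congr_ae (h : IsH1 Ω u G) (hu : u' =ᵐ[volume.restrict Ω] u)
    (hG : G' =ᵐ[volume.restrict Ω] G) : IsH1 Ω u' G' where
  memLp := (memLp_congr_ae hu).2 h.memLp
  memLp_grad := (memLp_congr_ae hG).2 h.memLp_grad
  integral_eq ψ hψ hc hs v := by
    have e1 : ∫ x in Ω, u' x * fderiv ℝ ψ x v = ∫ x in Ω, u x * fderiv ℝ ψ x v :=
      integral_congr_ae (by filter_upwards [hu] with x hx; rw [hx])
    have e2 : ∫ x in Ω, inner ℝ (G' x) v * ψ x = ∫ x in Ω, inner ℝ (G x) v * ψ x :=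
      integral_congr_ae (by filter_upwards [hG] with x hx; rw [hx])
    rw [e1, e2]
    exact h.integral_eq ψ hψ hc hs v

/-- The Hilbert space `L²(Ω) × L²(Ω; ℝᵈ)`. -/
abbrev L2Pairs (Ω : Set (EuclideanSpace ℝ (Fin d))) :=
  WithLp 2 (Lp ℝ 2 (volume.restrict Ω) × Lp (EuclideanSpace ℝ (Fin d)) 2 (volume.restrict Ω))

/-- The pairs `(∂ᵥψ, ψ v)`, whose orthogonal complement is the graph of the weak gradient. -/
def divergencePairs (Ω : Set (EuclideanSpace ℝ (Fin d))) : Set (L2Pairs Ω) :=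
  {w | ∃ (ψ : EuclideanSpace ℝ (Fin d) → ℝ) (v : EuclideanSpace ℝ (Fin d)),
    ContDiff ℝ ∞ ψ ∧ HasCompactSupport ψ ∧ tsupport ψ ⊆ interior Ω ∧
    w.fst =ᵐ[volume.restrict Ω] (fun x => fderiv ℝ ψ x v) ∧
    w.snd =ᵐ[volume.restrict Ω] (fun x => ψ x • v)}

/-- The Sobolev space `H¹(Ω)`, as the graph of the weak gradient. -/
def sobolevSpace (Ω : Set (EuclideanSpace ℝ (Fin d))) : Submodule ℝ (L2Pairs Ω) :=
  (Submodule.span ℝ (divergencePairs Ω))ᗮ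

instance : CompleteSpace (sobolevSpace Ω) :=
  inferInstanceAs (CompleteSpace ((Submodule.span ℝ (divergencePairs Ω))ᗮ : Submodule ℝ (L2Pairs Ω)))

lemma memLp_fderiv_apply {ψ : EuclideanSpace ℝ (Fin d) → ℝ} (hψ : ContDiff ℝ ∞ ψ)
    (hc : HasCompactSupport ψ) (v : EuclideanSpace ℝ (Fin d)) :
    MemLp (fun x => fderiv ℝ ψ x v) 2 (volume.restrict Ω) :=
  Continuous.memLp_of_hasCompactSupport
    ((hψ.continuous_fderiv (by simp)).clm_apply continuous_const) (hc.fderiv_apply ℝ v)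

lemma memLp_smul_const {ψ : EuclideanSpace ℝ (Fin d) → ℝ} (hψ : ContDiff ℝ ∞ ψ)
    (hc : HasCompactSupport ψ) (v : EuclideanSpace ℝ (Fin d)) :
    MemLp (fun x => ψ x • v) 2 (volume.restrict Ω) :=
  Continuous.memLp_of_hasCompactSupport
    (hψ.continuous.smul continuous_const) hc.smul_right

lemma L2Pairs.inner_eq_integral (a w : L2Pairs Ω) : inner ℝ a w =
    (∫ x in Ω, w.fst x * a.fst x) + ∫ x in Ω, inner ℝ (a.snd x) (w.snd x) := by
  rw [WithLp.prod_inner_apply, L2.inner_def, L2.inner_def]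
  rfl

/-- Pairing with `(∂ᵥψ, ψ v)` yields the difference of the two sides of the weak gradient identity.
Hence `H¹(Ω)` is an orthogonal complement, and its completeness comes for free. -/
lemma mem_sobolevSpace_iff {w : L2Pairs Ω} : w ∈ sobolevSpace Ω ↔ IsH1 Ω w.fst w.snd := by
  have key : ∀ a ∈ divergencePairs Ω, ∀ (ψ : EuclideanSpace ℝ (Fin d) → ℝ) v,
      a.fst =ᵐ[volume.restrict Ω] (fun x => fderiv ℝ ψ x v) →
      a.snd =ᵐ[volume.restrict Ω] (fun x => ψ x • v) →
      inner ℝ a w = (∫ x in Ω, w.fst x * fderiv ℝ ψ x v) +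
        ∫ x in Ω, inner ℝ (w.snd x) v * ψ x := by
    intro a _ ψ v h1 h2
    rw [L2Pairs.inner_eq_integral]
    congr 1
    · exact integral_congr_ae (by filter_upwards [h1] with x hx; rw [hx])
    · refine integral_congr_ae (by
        filter_upwards [h2] with x hx
        rw [hx, inner_smul_left, real_inner_comm]
        simp [mul_comm])
  constructor
  · intro hw
    refine ⟨Lp.memLp _, Lp.memLp _, fun ψ hψ hc hs v => ?_⟩
    have hmem : (WithLp.toLp 2 ((memLp_fderiv_apply hψ hc v).toLp _,
        (memLp_smul_const hψ hc v).toLp _) : L2Pairs Ω) ∈ divergencePairs Ω :=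
      ⟨ψ, v, hψ, hc, hs, MemLp.coeFn_toLp (memLp_fderiv_apply hψ hc v),
        MemLp.coeFn_toLp (memLp_smul_const hψ hc v)⟩
    have h0 := (Submodule.mem_orthogonal _ _).1 hw _ (Submodule.subset_span hmem)
    rw [key _ hmem ψ v (MemLp.coeFn_toLp (memLp_fderiv_apply hψ hc v))
      (MemLp.coeFn_toLp (memLp_smul_const hψ hc v))] at h0
    linarith
  · intro hw
    have : Submodule.span ℝ (divergencePairs Ω) ≤ (Submodule.span ℝ {w})ᗮ := by
      refine Submodule.span_le.2 fun a ha => ?_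
      obtain ⟨ψ, v, hψ, hc, hs, h1, h2⟩ := id ha
      refine (Submodule.mem_orthogonal_singleton_iff_inner_left).2 ?_
      rw [key a ha ψ v h1 h2, hw.integral_eq ψ hψ hc hs v]
      simp
    refine (Submodule.mem_orthogonal _ _).2 fun a ha => ?_
    exact (Submodule.mem_orthogonal_singleton_iff_inner_left).1 (this ha)

/-- The Sobolev space `H¹(Ω)` as a Hilbert space. -/
def SobolevH1 (Ω : Set (EuclideanSpace ℝ (Fin d))) : Type := sobolevSpace Ω

namespace SobolevH1

instance : NormedAddCommGroup (SobolevH1 Ω) := inferInstanceAs (NormedAddCommGroup (sobolevSpace Ω))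

instance : InnerProductSpace ℝ (SobolevH1 Ω) :=
  inferInstanceAs (InnerProductSpace ℝ (sobolevSpace Ω))

instance : CompleteSpace (SobolevH1 Ω) := inferInstanceAs (CompleteSpace (sobolevSpace Ω))

/-- The function underlying an element of `H¹(Ω)`, as an element of `L²(Ω)`. -/
def value (Ω : Set (EuclideanSpace ℝ (Fin d))) :
    SobolevH1 Ω →L[ℝ] Lp ℝ 2 (volume.restrict Ω) :=
  (WithLp.fstL 2 ℝ _ _).comp (sobolevSpace Ω).subtypeL

/-- The weak gradient on `H¹(Ω)`. -/
def grad (Ω : Set (EuclideanSpace ℝ (Fin d))) :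
    SobolevH1 Ω →L[ℝ] Lp (EuclideanSpace ℝ (Fin d)) 2 (volume.restrict Ω) :=
  (WithLp.sndL 2 ℝ _ _).comp (sobolevSpace Ω).subtypeL

lemma isH1 (p : SobolevH1 Ω) : IsH1 Ω (value Ω p) (grad Ω p) :=
  mem_sobolevSpace_iff.1 p.2

lemma norm_sq_eq (p : SobolevH1 Ω) : ‖p‖ ^ 2 = ‖value Ω p‖ ^ 2 + ‖grad Ω p‖ ^ 2 :=
  WithLp.prod_norm_sq_eq_of_L2 (p.1 : L2Pairs Ω)

end SobolevH1

lemma IsH1.exists_sobolevH1 (h : IsH1 Ω u G) : ∃ p : SobolevH1 Ω,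
    SobolevH1.value Ω p =ᵐ[volume.restrict Ω] u ∧
    SobolevH1.grad Ω p =ᵐ[volume.restrict Ω] G := by
  have hm : (WithLp.toLp 2 (h.memLp.toLp _, h.memLp_grad.toLp _) : L2Pairs Ω) ∈ sobolevSpace Ω :=
    mem_sobolevSpace_iff.2 (h.congr_ae (MemLp.coeFn_toLp h.memLp) (MemLp.coeFn_toLp h.memLp_grad))
  exact ⟨⟨_, hm⟩, MemLp.coeFn_toLp h.memLp, MemLp.coeFn_toLp h.memLp_grad⟩

/-- The frontier of a convex set is a null set. -/
lemma ae_restrict_of_ae_restrict_interior (hconv : Convex ℝ Ω) {P : EuclideanSpace ℝ (Fin d) → Prop}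
    (h : ∀ᵐ x, x ∈ interior Ω → P x) : ∀ᵐ x ∂(volume.restrict Ω), P x := by
  have h0 : ∀ᵐ x : EuclideanSpace ℝ (Fin d), x ∉ frontier Ω :=
    measure_eq_zero_iff_ae_notMem.1 (hconv.addHaar_frontier volume)
  have hm : NullMeasurableSet Ω volume :=
    hconv.nullMeasurableSet volume
  rw [ae_restrict_iff'₀ hm]
  filter_upwards [h, h0] with x hx hx' hxΩ
  refine hx ?_
  by_contra hcon
  exact hx' ⟨subset_closure hxΩ, hcon⟩

/-- The weak gradient is unique, even among locally integrable vector fields. -/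
lemma ae_eq_of_weak_gradient (hconv : Convex ℝ Ω)
    (hG : LocallyIntegrableOn G (interior Ω)) (hG' : LocallyIntegrableOn G' (interior Ω))
    (h : ∀ ψ : EuclideanSpace ℝ (Fin d) → ℝ, ContDiff ℝ ∞ ψ → HasCompactSupport ψ →
      tsupport ψ ⊆ interior Ω → ∀ v : EuclideanSpace ℝ (Fin d),
      ∫ x in Ω, inner ℝ (G x) v * ψ x = ∫ x in Ω, inner ℝ (G' x) v * ψ x) :
    G =ᵐ[volume.restrict Ω] G' := by
  refine ae_restrict_of_ae_restrict_interior hconv ?_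
  suffices hi : ∀ i : Fin d, ∀ᵐ x, x ∈ interior Ω → G x i - G' x i = 0 by
    filter_upwards [ae_all_iff.2 hi] with x hx hxΩ
    ext i
    linarith [hx i hxΩ]
  intro i
  have hcomp : ∀ F : EuclideanSpace ℝ (Fin d) → EuclideanSpace ℝ (Fin d),
      LocallyIntegrableOn F (interior Ω) → LocallyIntegrableOn (fun x => F x i) (interior Ω) := by
    intro F hF x hx
    obtain ⟨s, hs, hFs⟩ := hF x hx
    exact ⟨s, hs, (EuclideanSpace.proj (𝕜 := ℝ) i).integrable_comp hFs⟩
  have hint : ∀ F : EuclideanSpace ℝ (Fin d) → EuclideanSpace ℝ (Fin d),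
      LocallyIntegrableOn F (interior Ω) → ∀ ψ : EuclideanSpace ℝ (Fin d) → ℝ,
      Continuous ψ → HasCompactSupport ψ → tsupport ψ ⊆ interior Ω →
      Integrable (fun x => ψ x * F x i) := by
    intro F hF ψ hψ hc hs
    have h1 : IntegrableOn (fun x => F x i) (tsupport ψ) :=
      ((hcomp F hF).mono_set hs).integrableOn_isCompact hc
    have h2 := h1.continuousOn_mul hψ.continuousOn hc
    refine (integrableOn_iff_integrable_of_support_subset ?_).1 h2
    intro x hx
    refine subset_tsupport ψ ?_
    intro h0
    exact hx (by simp [h0])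
  -- The fundamental lemma of the calculus of variations, applied to one coordinate at a time with
  -- `v` a basis vector.
  refine isOpen_interior.ae_eq_zero_of_integral_contDiff_smul_eq_zero
    ((hcomp G hG).sub (hcomp G' hG')) fun ψ hψ hc hs => ?_
  have hset : ∀ F : EuclideanSpace ℝ (Fin d) → EuclideanSpace ℝ (Fin d),
      ∫ x in Ω, inner ℝ (F x) (EuclideanSpace.single i (1 : ℝ)) * ψ x = ∫ x, ψ x * F x i := by
    intro F
    rw [setIntegral_eq_integral_of_forall_compl_eq_zero]
    · simp [EuclideanSpace.inner_single_right, mul_comm]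
    · intro x hx
      rw [image_eq_zero_of_notMem_tsupport fun hx' => hx (interior_subset (hs hx')), mul_zero]
  have := h ψ hψ hc hs (EuclideanSpace.single i 1)
  rw [hset, hset] at this
  simp only [smul_eq_mul, mul_sub]
  rw [integral_sub (hint G hG ψ hψ.continuous hc hs) (hint G' hG' ψ hψ.continuous hc hs), this,
    sub_self]

lemma IsH1.locallyIntegrableOn (hΩ : IsCompact Ω) (h : IsH1 Ω u G) :
    LocallyIntegrableOn G (interior Ω) := by
  have : IsFiniteMeasure (volume.restrict Ω) := ⟨by simpa using hΩ.measure_lt_top⟩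
  have h1 : IntegrableOn G Ω := h.memLp_grad.integrable (by norm_num)
  exact (h1.mono_set interior_subset).locallyIntegrableOn

lemma IsH1.grad_ae_eq (hΩ : IsCompact Ω) (hconv : Convex ℝ Ω) (h : IsH1 Ω u G)
    (h' : IsH1 Ω u' G') (hu : u =ᵐ[volume.restrict Ω] u') : G =ᵐ[volume.restrict Ω] G' := by
  refine ae_eq_of_weak_gradient hconv (h.locallyIntegrableOn hΩ) (h'.locallyIntegrableOn hΩ) ?_
  intro ψ hψ hc hs v
  have h1 := h.integral_eq ψ hψ hc hs v
  have h2 := (h'.congr_ae hu EventuallyEq.rfl).integral_eq ψ hψ hc hs v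
  linarith

lemma IsH1.isH1_weakGradient (h : IsH1 Ω u G) : IsH1 Ω u (weakGradient Ω u) := by
  have hex : ∃ G, IsH1 Ω u G := ⟨G, h⟩
  rw [weakGradient, dif_pos hex]
  exact hex.choose_spec

end Sobolev

/-! ### The weak elliptic problem as an operator equation in `H¹(Ω)`. -/

section Elliptic

variable {d : ℕ} {Ω : Set (EuclideanSpace ℝ (Fin d))}
  {u u' : EuclideanSpace ℝ (Fin d) → ℝ} {G G' : EuclideanSpace ℝ (Fin d) → EuclideanSpace ℝ (Fin d)}

namespace SobolevH1

/-- Multiplication of a vector field by a bounded function. -/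
def mulOp (Ω : Set (EuclideanSpace ℝ (Fin d))) : Lp ℝ ⊤ (volume.restrict Ω) →L[ℝ]
    Lp (EuclideanSpace ℝ (Fin d)) 2 (volume.restrict Ω) →L[ℝ]
    Lp (EuclideanSpace ℝ (Fin d)) 2 (volume.restrict Ω) :=
  (ContinuousLinearMap.lsmul ℝ ℝ).holderL (volume.restrict Ω) ⊤ 2 2

lemma coeFn_mulOp (ρ : Lp ℝ ⊤ (volume.restrict Ω))
    (F : Lp (EuclideanSpace ℝ (Fin d)) 2 (volume.restrict Ω)) :
    mulOp Ω ρ F =ᵐ[volume.restrict Ω] fun x => ρ x • F x :=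
  (ContinuousLinearMap.lsmul ℝ ℝ).coeFn_holder (r := 2) ρ F

lemma inner_mulOp (ρ : Lp ℝ ⊤ (volume.restrict Ω))
    (F H : Lp (EuclideanSpace ℝ (Fin d)) 2 (volume.restrict Ω)) :
    inner ℝ (mulOp Ω ρ F) H = ∫ x in Ω, ρ x * inner ℝ (F x) (H x) := by
  rw [L2.inner_def]
  refine integral_congr_ae ?_
  filter_upwards [coeFn_mulOp ρ F] with x hx
  rw [hx, inner_smul_left, conj_trivial]

/-- The operator of the form `(p, q) ↦ ∫ ρ ∇p·∇q` on `H¹(Ω)`, linear in `ρ ∈ L^∞(Ω)`. -/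
def gradForm (Ω : Set (EuclideanSpace ℝ (Fin d))) :
    Lp ℝ ⊤ (volume.restrict Ω) →L[ℝ] SobolevH1 Ω →L[ℝ] SobolevH1 Ω :=
  conjOp (grad Ω) (mulOp Ω)

/-- The functional `q ↦ ∫ g q` on `H¹(Ω)`. -/
def load (Ω : Set (EuclideanSpace ℝ (Fin d))) :
    Lp ℝ 2 (volume.restrict Ω) →L[ℝ] SobolevH1 Ω :=
  ContinuousLinearMap.adjoint (value Ω)

/-- The operator of the form `(p, q) ↦ ∫ ρ ∇p·∇q + α ∫ p q` on `H¹(Ω)`. -/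
def ellipticOp (Ω : Set (EuclideanSpace ℝ (Fin d))) (α : ℝ) (ρ : Lp ℝ ⊤ (volume.restrict Ω)) :
    SobolevH1 Ω →L[ℝ] SobolevH1 Ω :=
  α • (load Ω).comp (value Ω) + gradForm Ω ρ

lemma inner_load (g : Lp ℝ 2 (volume.restrict Ω)) (q : SobolevH1 Ω) :
    inner ℝ (load Ω g) q = ∫ x in Ω, g x * value Ω q x := by
  rw [load, ContinuousLinearMap.adjoint_inner_left, L2.inner_def]
  simp [mul_comm]

lemma inner_gradForm (ρ : Lp ℝ ⊤ (volume.restrict Ω)) (p q : SobolevH1 Ω) :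
    inner ℝ (gradForm Ω ρ p) q = ∫ x in Ω, ρ x * inner ℝ (grad Ω p x) (grad Ω q x) := by
  rw [gradForm, inner_conjOp, inner_mulOp]

lemma inner_ellipticOp (α : ℝ) (ρ : Lp ℝ ⊤ (volume.restrict Ω)) (p q : SobolevH1 Ω) :
    inner ℝ (ellipticOp Ω α ρ p) q = α * (∫ x in Ω, value Ω p x * value Ω q x) +
      ∫ x in Ω, ρ x * inner ℝ (grad Ω p x) (grad Ω q x) := by
  rw [← inner_gradForm, ← inner_load]
  have : ellipticOp Ω α ρ p = α • load Ω (value Ω p) + gradForm Ω ρ p := rfl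
  rw [this, inner_add_left, inner_smul_left, conj_trivial]

lemma ellipticOp_symm (α : ℝ) (ρ : Lp ℝ ⊤ (volume.restrict Ω)) (p q : SobolevH1 Ω) :
    inner ℝ (ellipticOp Ω α ρ p) q = inner ℝ p (ellipticOp Ω α ρ q) := by
  rw [real_inner_comm _ p, inner_ellipticOp, inner_ellipticOp]
  congr 2
  · simp only [mul_comm]
  · ext x
    rw [real_inner_comm]

/-- Being affine in the coefficient is what allows the exact expansion of
`abs_inner_sub_le_of_coercive`. -/
lemma ellipticOp_add_smul (α h : ℝ) (ρ σ : Lp ℝ ⊤ (volume.restrict Ω)) :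
    ellipticOp Ω α (ρ + h • σ) = ellipticOp Ω α ρ + h • gradForm Ω σ := by
  simp [ellipticOp, add_assoc]

/-- The term with `α` controls the `L²` norm of the function and the term with `ρ` that of the
gradient; together these are the `H¹` norm. -/
lemma ellipticOp_coercive {α c : ℝ} (hcα : c ≤ α) {ρ : Lp ℝ ⊤ (volume.restrict Ω)}
    (hρ : ∀ᵐ x ∂(volume.restrict Ω), c ≤ ρ x) (p : SobolevH1 Ω) :
    c * ‖p‖ ^ 2 ≤ inner ℝ (ellipticOp Ω α ρ p) p := by
  have hint : Integrable (fun x => ρ x * inner ℝ (grad Ω p x) (grad Ω p x))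
      (volume.restrict Ω) := by
    refine (L2.integrable_inner (𝕜 := ℝ) (mulOp Ω ρ (grad Ω p)) (grad Ω p)).congr ?_
    filter_upwards [coeFn_mulOp ρ (grad Ω p)] with x hx
    rw [hx, inner_smul_left, conj_trivial]
  have h1 : c * ‖grad Ω p‖ ^ 2 ≤ ∫ x in Ω, ρ x * inner ℝ (grad Ω p x) (grad Ω p x) := by
    rw [← real_inner_self_eq_norm_sq, L2.inner_def, ← integral_const_mul]
    refine integral_mono_ae ((L2.integrable_inner _ _).const_mul c) hint ?_
    filter_upwards [hρ] with x hx
    exact mul_le_mul_of_nonneg_right hx real_inner_self_nonneg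
  have h2 : ∫ x in Ω, value Ω p x * value Ω p x = ‖value Ω p‖ ^ 2 := by
    rw [← real_inner_self_eq_norm_sq, L2.inner_def]; rfl
  rw [inner_ellipticOp, h2, norm_sq_eq, mul_add]
  exact add_le_add (mul_le_mul_of_nonneg_right hcα (sq_nonneg _)) h1

end SobolevH1

open SobolevH1

lemma integrable_mul_of_memLp {f g : EuclideanSpace ℝ (Fin d) → ℝ}
    (hf : MemLp f 2 (volume.restrict Ω)) (hg : MemLp g 2 (volume.restrict Ω)) :
    Integrable (fun x => f x * g x) (volume.restrict Ω) := hf.integrable_mul hg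

/-- Elements of the abstract space solving `A p = g` are resolvents. -/
lemma isResolvent_of_ellipticOp {α : ℝ} {r g : EuclideanSpace ℝ (Fin d) → ℝ}
    {ρ : Lp ℝ ⊤ (volume.restrict Ω)} {γ : Lp ℝ 2 (volume.restrict Ω)}
    (hρ : ρ =ᵐ[volume.restrict Ω] r) (hγ : γ =ᵐ[volume.restrict Ω] g)
    {p : SobolevH1 Ω} (hp : ellipticOp Ω α ρ p = load Ω γ) :
    IsResolvent Ω α r g (value Ω p) := by
  have hg : MemLp g 2 (volume.restrict Ω) := (memLp_congr_ae hγ).1 (Lp.memLp γ)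
  refine ⟨hg.sub ((Lp.memLp (value Ω p)).const_mul α), grad Ω p, isH1 p, fun φ H hφ => ?_⟩
  obtain ⟨q, hq1, hq2⟩ := hφ.exists_sobolevH1
  have h1 : inner ℝ (ellipticOp Ω α ρ p) q = inner ℝ (load Ω γ) q := by rw [hp]
  rw [inner_ellipticOp, inner_load] at h1
  have e1 : ∫ x in Ω, ρ x * inner ℝ (grad Ω p x) (grad Ω q x) =
      ∫ x in Ω, r x * inner ℝ (grad Ω p x) (H x) :=
    integral_congr_ae (by filter_upwards [hρ, hq2] with x h1 h2; rw [h1, h2])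
  have e2 : ∫ x in Ω, value Ω p x * value Ω q x = ∫ x in Ω, value Ω p x * φ x :=
    integral_congr_ae (by filter_upwards [hq1] with x h1; rw [h1])
  have e3 : ∫ x in Ω, γ x * value Ω q x = ∫ x in Ω, g x * φ x :=
    integral_congr_ae (by filter_upwards [hγ, hq1] with x h1 h2; rw [h1, h2])
  have e4 : ∫ x in Ω, (g x - α * value Ω p x) * φ x =
      (∫ x in Ω, g x * φ x) - α * ∫ x in Ω, value Ω p x * φ x := by
    rw [← integral_const_mul, ← integral_sub (integrable_mul_of_memLp hg hφ.memLp)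
      ((integrable_mul_of_memLp (Lp.memLp (value Ω p)) hφ.memLp).const_mul α)]
    exact integral_congr_ae (Eventually.of_forall fun x => by ring)
  rw [e4, ← e1, ← e2, ← e3]
  linarith

/-- The weak formulation only asserts that some gradient `G` exists; uniqueness of the weak gradient
replaces it by `weakGradient Ω u`. -/
lemma IsResolvent.exists_ellipticOp (hΩ : IsCompact Ω) (hconv : Convex ℝ Ω) {α : ℝ}
    {r g : EuclideanSpace ℝ (Fin d) → ℝ} {ρ : Lp ℝ ⊤ (volume.restrict Ω)}
    {γ : Lp ℝ 2 (volume.restrict Ω)} (hρ : ρ =ᵐ[volume.restrict Ω] r)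
    (hγ : γ =ᵐ[volume.restrict Ω] g) (h : IsResolvent Ω α r g u) :
    ∃ p : SobolevH1 Ω, ellipticOp Ω α ρ p = load Ω γ ∧
      value Ω p =ᵐ[volume.restrict Ω] u ∧ grad Ω p =ᵐ[volume.restrict Ω] weakGradient Ω u := by
  obtain ⟨-, G, hG, hsol⟩ := h
  obtain ⟨p, hp1, hp2⟩ := hG.exists_sobolevH1
  have hg : MemLp g 2 (volume.restrict Ω) := (memLp_congr_ae hγ).1 (Lp.memLp γ)
  refine ⟨p, ext_inner_right ℝ fun q => ?_, hp1,
    hp2.trans (hG.grad_ae_eq hΩ hconv hG.isH1_weakGradient EventuallyEq.rfl)⟩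
  rw [inner_ellipticOp, inner_load]
  have h1 := hsol _ _ (isH1 q)
  have e1 : ∫ x in Ω, ρ x * inner ℝ (grad Ω p x) (grad Ω q x) =
      ∫ x in Ω, r x * inner ℝ (G x) (grad Ω q x) :=
    integral_congr_ae (by filter_upwards [hρ, hp2] with x h1 h2; rw [h1, h2])
  have e2 : ∫ x in Ω, value Ω p x * value Ω q x = ∫ x in Ω, u x * value Ω q x :=
    integral_congr_ae (by filter_upwards [hp1] with x h1; rw [h1])
  have e3 : ∫ x in Ω, γ x * value Ω q x = ∫ x in Ω, g x * value Ω q x :=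
    integral_congr_ae (by filter_upwards [hγ] with x h1; rw [h1])
  have e4 : ∫ x in Ω, (g x - α * u x) * value Ω q x =
      (∫ x in Ω, g x * value Ω q x) - α * ∫ x in Ω, u x * value Ω q x := by
    rw [← integral_const_mul, ← integral_sub (integrable_mul_of_memLp hg (Lp.memLp (value Ω q)))
      ((integrable_mul_of_memLp hG.memLp (Lp.memLp (value Ω q))).const_mul α)]
    exact integral_congr_ae (Eventually.of_forall fun x => by ring)
  rw [e1, e2, e3, h1, e4]
  ring

/-- Existence and uniqueness for the weak elliptic problem with bounded coefficients. -/
lemma exists_isResolvent (hΩ : IsCompact Ω) (hconv : Convex ℝ Ω) {α c : ℝ} (hc : 0 < c)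
    (hcα : c ≤ α) {r g : EuclideanSpace ℝ (Fin d) → ℝ} (hr : MemLp r ⊤ (volume.restrict Ω))
    (hg : MemLp g 2 (volume.restrict Ω)) (hcr : ∀ᵐ x ∂(volume.restrict Ω), c ≤ r x) :
    ∃ u, IsResolvent Ω α r g u ∧ ∀ w, IsResolvent Ω α r g w → w =ᵐ[volume.restrict Ω] u := by
  have hcoer := ellipticOp_coercive hcα (ρ := hr.toLp r)
    (by filter_upwards [hr.coeFn_toLp, hcr] with x h1 h2; rwa [h1])
  obtain ⟨p, hp⟩ := exists_eq_of_coercive hc hcoer (load Ω (hg.toLp g))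
  refine ⟨value Ω p, isResolvent_of_ellipticOp hr.coeFn_toLp hg.coeFn_toLp hp, fun w hw => ?_⟩
  obtain ⟨q, hq, hqw, -⟩ := hw.exists_ellipticOp hΩ hconv hr.coeFn_toLp hg.coeFn_toLp
  have h0 := norm_le_of_coercive hcoer (p - q)
  rw [map_sub, hp, hq, sub_self, norm_zero] at h0
  have : p = q := sub_eq_zero.1 (norm_eq_zero.1 (le_antisymm
    (nonpos_of_mul_nonpos_right h0 hc) (norm_nonneg _)))
  rw [this]
  exact hqw.symm

end Elliptic

/-! ### Density paths and the curve of solutions in `H¹(Ω)`. -/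

section Paths

variable {d : ℕ} {Ω : Set (EuclideanSpace ℝ (Fin d))}

lemma ContinuousOn.memLp_restrict (hΩ : IsCompact Ω) {f : EuclideanSpace ℝ (Fin d) → ℝ}
    (hf : ContinuousOn f Ω) (p : ENNReal) : MemLp f p (volume.restrict Ω) := by
  have : IsFiniteMeasure (volume.restrict Ω) := ⟨by simpa using hΩ.measure_lt_top⟩
  obtain ⟨C, hC⟩ := hΩ.exists_bound_of_continuousOn hf
  exact MemLp.of_bound (hf.aestronglyMeasurable hΩ.measurableSet) C
    ((ae_restrict_iff' hΩ.measurableSet).2 (Eventually.of_forall hC))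

open Classical in
/-- The class in `Lᵖ(Ω)` of a function. -/
def restrictLp (Ω : Set (EuclideanSpace ℝ (Fin d))) (p : ENNReal)
    (f : EuclideanSpace ℝ (Fin d) → ℝ) : Lp ℝ p (volume.restrict Ω) :=
  if h : MemLp f p (volume.restrict Ω) then h.toLp f else 0

lemma coeFn_restrictLp (hΩ : IsCompact Ω) {p : ENNReal} {f : EuclideanSpace ℝ (Fin d) → ℝ}
    (hf : ContinuousOn f Ω) : restrictLp Ω p f =ᵐ[volume.restrict Ω] f := by
  rw [restrictLp, dif_pos (hf.memLp_restrict hΩ p)]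
  exact MemLp.coeFn_toLp _

lemma restrictLp_congr_add_smul (hΩ : IsCompact Ω) {p : ENNReal}
    {f g k : EuclideanSpace ℝ (Fin d) → ℝ} {h : ℝ} (hf : ContinuousOn f Ω) (hg : ContinuousOn g Ω)
    (hk : ∀ x ∈ Ω, k x = f x + h * g x) :
    restrictLp Ω p k = restrictLp Ω p f + h • restrictLp Ω p g := by
  have hkc : ContinuousOn k Ω := (hf.add (hg.const_mul h)).congr hk
  refine Lp.ext ?_
  filter_upwards [coeFn_restrictLp (p := p) hΩ hf, coeFn_restrictLp (p := p) hΩ hg,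
    coeFn_restrictLp (p := p) hΩ hkc, Lp.coeFn_add (restrictLp Ω p f) (h • restrictLp Ω p g),
    Lp.coeFn_smul h (restrictLp Ω p g), ae_restrict_mem hΩ.measurableSet]
    with x h1 h2 h3 h4 h5 h6
  rw [h3, h4, Pi.add_apply, h5, Pi.smul_apply, h1, h2, hk x h6, smul_eq_mul]

lemma ContinuousOn.slice {X : Type*} [TopologicalSpace X] {f : ℝ → EuclideanSpace ℝ (Fin d) → X}
    {T : Set ℝ} (hf : ContinuousOn (fun p : ℝ × EuclideanSpace ℝ (Fin d) => f p.1 p.2) (T ×ˢ Ω))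
    {t : ℝ} (ht : t ∈ T) : ContinuousOn (f t) Ω :=
  hf.comp (f := fun x => (t, x)) (by fun_prop) fun _ hx => ⟨ht, hx⟩

/-- Uniform continuity on the compact cylinder makes the slices continuous in the sup norm, which
dominates every `Lᵖ` norm on a set of finite measure. -/
lemma continuousOn_restrictLp (hΩ : IsCompact Ω) (p : ENNReal) [Fact (1 ≤ p)]
    {f : ℝ → EuclideanSpace ℝ (Fin d) → ℝ}
    (hf : ContinuousOn (fun p : ℝ × EuclideanSpace ℝ (Fin d) => f p.1 p.2) (Icc 0 1 ×ˢ Ω)) :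
    ContinuousOn (fun t => restrictLp Ω p (f t)) (Icc 0 1) := by
  have : IsFiniteMeasure (volume.restrict Ω) := ⟨by simpa using hΩ.measure_lt_top⟩
  have hu := (isCompact_Icc.prod hΩ).uniformContinuousOn_of_continuous hf
  rw [Metric.uniformContinuousOn_iff] at hu
  rw [Metric.continuousOn_iff]
  intro s hs ε hε
  -- `K` is the factor between the sup bound and the `Lᵖ` norm. For `p = ⊤` the exponent is `0⁻¹ =
  -- 0`, so `K = 1`. Dividing by `K + 1` avoids any case distinction.
  set K : ℝ := (measureUnivNNReal (volume.restrict Ω) : ℝ) ^ p.toReal⁻¹ with hK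
  have hK0 : 0 ≤ K := by positivity
  obtain ⟨δ, hδ, H⟩ := hu (ε / (K + 1)) (by positivity)
  refine ⟨δ, hδ, fun t ht hts => ?_⟩
  have hae : ∀ᵐ x ∂(volume.restrict Ω),
      ‖(restrictLp Ω p (f t) - restrictLp Ω p (f s)) x‖ ≤ ε / (K + 1) := by
    filter_upwards [coeFn_restrictLp (p := p) hΩ (hf.slice ht),
      coeFn_restrictLp (p := p) hΩ (hf.slice hs),
      Lp.coeFn_sub (restrictLp Ω p (f t)) (restrictLp Ω p (f s)),
      ae_restrict_mem hΩ.measurableSet] with x h1 h2 h3 h4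
    rw [h3, Pi.sub_apply, h1, h2, ← dist_eq_norm]
    refine (H (t, x) ⟨ht, h4⟩ (s, x) ⟨hs, h4⟩ ?_).le
    simpa [Prod.dist_eq, hδ] using hts
  have h1 := Lp.norm_le_of_ae_bound (by positivity) hae
  rw [dist_eq_norm]
  refine h1.trans_lt ?_
  change K * (ε / (K + 1)) < ε
  rw [mul_div_assoc', div_lt_iff₀ (by positivity)]
  nlinarith

/-! ### Regularity of a function that is `C¹` on `[0, 1] × Ω` -/

lemma uniqueDiffOn_cylinder (hconv : Convex ℝ Ω) (hne : (interior Ω).Nonempty) :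
    UniqueDiffOn ℝ (Icc (0 : ℝ) 1 ×ˢ Ω) :=
  (uniqueDiffOn_Icc zero_lt_one).prod (uniqueDiffOn_convex hconv hne)

lemma ContDiffOn.hasDerivWithinAt_slice
    {f : ℝ → EuclideanSpace ℝ (Fin d) → ℝ}
    (hf : ContDiffOn ℝ 1 (fun p : ℝ × EuclideanSpace ℝ (Fin d) => f p.1 p.2) (Icc 0 1 ×ˢ Ω))
    {t : ℝ} (ht : t ∈ Icc (0 : ℝ) 1) {x : EuclideanSpace ℝ (Fin d)} (hx : x ∈ Ω) :
    HasDerivWithinAt (fun s => f s x) (fderivWithin ℝ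
      (fun p : ℝ × EuclideanSpace ℝ (Fin d) => f p.1 p.2) (Icc 0 1 ×ˢ Ω) (t, x) (1, 0))
      (Icc 0 1) t := by
  have h1 := ((hf.differentiableOn one_ne_zero) (t, x) ⟨ht, hx⟩).hasFDerivWithinAt
  have h2 : HasDerivWithinAt (fun s : ℝ => (s, x)) (1, 0) (Icc 0 1) t :=
    (hasDerivWithinAt_id t _).prodMk (hasDerivWithinAt_const t _ x)
  exact h1.comp_hasDerivWithinAt t h2 fun s hs => mk_mem_prod hs hx

lemma ContDiffOn.timeDeriv_eq
    {f : ℝ → EuclideanSpace ℝ (Fin d) → ℝ}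
    (hf : ContDiffOn ℝ 1 (fun p : ℝ × EuclideanSpace ℝ (Fin d) => f p.1 p.2) (Icc 0 1 ×ˢ Ω))
    {t : ℝ} (ht : t ∈ Icc (0 : ℝ) 1) {x : EuclideanSpace ℝ (Fin d)} (hx : x ∈ Ω) :
    timeDeriv f t x = fderivWithin ℝ
      (fun p : ℝ × EuclideanSpace ℝ (Fin d) => f p.1 p.2) (Icc 0 1 ×ˢ Ω) (t, x) (1, 0) :=
  (hf.hasDerivWithinAt_slice ht hx).derivWithin (uniqueDiffOn_Icc zero_lt_one t ht)

lemma ContDiffOn.continuousOn_timeDeriv (hconv : Convex ℝ Ω) (hne : (interior Ω).Nonempty)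
    {f : ℝ → EuclideanSpace ℝ (Fin d) → ℝ}
    (hf : ContDiffOn ℝ 1 (fun p : ℝ × EuclideanSpace ℝ (Fin d) => f p.1 p.2) (Icc 0 1 ×ˢ Ω)) :
    ContinuousOn (fun p : ℝ × EuclideanSpace ℝ (Fin d) => timeDeriv f p.1 p.2) (Icc 0 1 ×ˢ Ω) :=
  ((hf.continuousOn_fderivWithin (uniqueDiffOn_cylinder hconv hne) le_rfl).clm_apply
    continuousOn_const).congr fun _ hp => hf.timeDeriv_eq hp.1 hp.2

lemma IsPerturbation.contDiffOn_one {η : ℝ → EuclideanSpace ℝ (Fin d) → ℝ}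
    (hη : IsPerturbation Ω η) :
    ContDiffOn ℝ 1 (fun p : ℝ × EuclideanSpace ℝ (Fin d) => η p.1 p.2) (Icc 0 1 ×ˢ Ω) :=
  ContDiffOn.of_le hη (by norm_cast)

/-! ### Positive paths and the curve of solutions -/

/-- The minimum over the compact cylinder is attained. Requiring also `c ≤ α` lets one constant
serve both terms of the elliptic form. -/
lemma IsPositivePath.exists_lower_bound (hΩ : IsCompact Ω) (hne : (interior Ω).Nonempty)
    {μ : ℝ → EuclideanSpace ℝ (Fin d) → ℝ} (hμ : IsPositivePath Ω μ) {α : ℝ} (hα : 0 < α) :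
    ∃ c, 0 < c ∧ c ≤ α ∧ ∀ t ∈ Icc (0 : ℝ) 1, ∀ x ∈ Ω, c ≤ μ t x := by
  obtain ⟨y, hy⟩ := hne
  obtain ⟨p, hp, hmin⟩ := (isCompact_Icc.prod hΩ).exists_isMinOn
    ⟨((0 : ℝ), y), left_mem_Icc.2 zero_le_one, interior_subset hy⟩ hμ.continuousOn
  refine ⟨min α (μ p.1 p.2), lt_min hα (hμ.pos _ hp.1 _ hp.2), min_le_left _ _,
    fun t ht x hx => (min_le_right _ _).trans ?_⟩
  exact hmin (show (t, x) ∈ Icc (0 : ℝ) 1 ×ˢ Ω from ⟨ht, hx⟩)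

lemma ae_le_restrictLp (hΩ : IsCompact Ω) {f : EuclideanSpace ℝ (Fin d) → ℝ} {c : ℝ}
    {p : ENNReal} (hf : ContinuousOn f Ω) (hc : ∀ x ∈ Ω, c ≤ f x) :
    ∀ᵐ x ∂(volume.restrict Ω), c ≤ restrictLp Ω p f x := by
  filter_upwards [coeFn_restrictLp (p := p) hΩ hf, ae_restrict_mem hΩ.measurableSet] with x h1 h2
  rw [h1]
  exact hc x h2

lemma IsPositivePath.exists_isResolvent (hΩ : IsCompact Ω) (hconv : Convex ℝ Ω)
    (hne : (interior Ω).Nonempty) {μ : ℝ → EuclideanSpace ℝ (Fin d) → ℝ}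
    (hμ : IsPositivePath Ω μ) {α : ℝ} (hα : 0 < α) {t : ℝ} (ht : t ∈ Icc (0 : ℝ) 1) :
    ∃ u, IsResolvent Ω α (μ t) (timeDeriv μ t) u ∧
      ∀ w, IsResolvent Ω α (μ t) (timeDeriv μ t) w → w =ᵐ[volume.restrict Ω] u := by
  obtain ⟨c, hc, hcα, hcμ⟩ := hμ.exists_lower_bound hΩ hne hα
  exact _root_.exists_isResolvent hΩ hconv hc hcα ((hμ.continuousOn.slice ht).memLp_restrict hΩ _)
    ((hμ.continuousOn_timeDeriv.slice ht).memLp_restrict hΩ _)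
    ((ae_restrict_iff' hΩ.measurableSet).2 (Eventually.of_forall (hcμ t ht)))

open SobolevH1

/-- `p` is the curve in `H¹(Ω)` of the functions `Φ t = (L_μ + α I)⁻¹ ∂ₜμ`. -/
structure IsSolutionCurve (Ω : Set (EuclideanSpace ℝ (Fin d))) (α : ℝ)
    (μ Φ : ℝ → EuclideanSpace ℝ (Fin d) → ℝ) (p : ℝ → SobolevH1 Ω) : Prop where
  eq : ∀ t ∈ Icc (0 : ℝ) 1, ellipticOp Ω α (restrictLp Ω ⊤ (μ t)) (p t) =
    load Ω (restrictLp Ω 2 (timeDeriv μ t))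
  value_eq : ∀ t ∈ Icc (0 : ℝ) 1, value Ω (p t) =ᵐ[volume.restrict Ω] Φ t
  grad_eq : ∀ t ∈ Icc (0 : ℝ) 1, grad Ω (p t) =ᵐ[volume.restrict Ω] weakGradient Ω (Φ t)
  continuousOn : ContinuousOn p (Icc 0 1)

/-- The representatives `Φ t` may be chosen independently for each `t`, but their classes are
determined. Continuity in time passes from `μ` and `∂ₜμ` to these classes through
`continuousOn_of_coercive`. -/
lemma exists_isSolutionCurve (hΩ : IsCompact Ω) (hconv : Convex ℝ Ω)
    (hne : (interior Ω).Nonempty) {μ Φ : ℝ → EuclideanSpace ℝ (Fin d) → ℝ}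
    (hμ : IsPositivePath Ω μ) {α : ℝ} (hα : 0 < α)
    (hΦ : ∀ t ∈ Icc (0 : ℝ) 1, IsResolvent Ω α (μ t) (timeDeriv μ t) (Φ t)) :
    ∃ p, IsSolutionCurve Ω α μ Φ p := by
  obtain ⟨c, hc, hcα, hcμ⟩ := hμ.exists_lower_bound hΩ hne hα
  have hex : ∀ t, ∃ p : SobolevH1 Ω, t ∈ Icc (0 : ℝ) 1 →
      ellipticOp Ω α (restrictLp Ω ⊤ (μ t)) p = load Ω (restrictLp Ω 2 (timeDeriv μ t)) ∧
      value Ω p =ᵐ[volume.restrict Ω] Φ t ∧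
      grad Ω p =ᵐ[volume.restrict Ω] weakGradient Ω (Φ t) := by
    intro t
    by_cases ht : t ∈ Icc (0 : ℝ) 1
    · obtain ⟨p, hp⟩ := (hΦ t ht).exists_ellipticOp hΩ hconv
        (coeFn_restrictLp hΩ (hμ.continuousOn.slice ht))
        (coeFn_restrictLp hΩ (hμ.continuousOn_timeDeriv.slice ht))
      exact ⟨p, fun _ => hp⟩
    · exact ⟨0, fun h => absurd h ht⟩
  choose p hp using hex
  refine ⟨p, fun t ht => (hp t ht).1, fun t ht => (hp t ht).2.1, fun t ht => (hp t ht).2.2, ?_⟩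
  refine continuousOn_of_coercive hc (A := fun t => ellipticOp Ω α (restrictLp Ω ⊤ (μ t)))
    (k := fun t => load Ω (restrictLp Ω 2 (timeDeriv μ t))) ?_ ?_ (fun t ht =>
      ellipticOp_coercive hcα (ae_le_restrictLp hΩ (hμ.continuousOn.slice ht) (hcμ t ht)))
    fun t ht => (hp t ht).1
  · exact continuousOn_const.add
      ((gradForm Ω).continuous.comp_continuousOn (continuousOn_restrictLp hΩ ⊤ hμ.continuousOn))
  · exact (load Ω).continuous.comp_continuousOn
      (continuousOn_restrictLp hΩ 2 hμ.continuousOn_timeDeriv)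

namespace IsSolutionCurve

variable {α : ℝ} {μ Φ f : ℝ → EuclideanSpace ℝ (Fin d) → ℝ} {p : ℝ → SobolevH1 Ω} {t : ℝ}

/-- Rewriting integrals of `Φ t` as Hilbert space pairings makes their continuity, and so their
measurability, in `t` visible. -/
lemma integral_mul (h : IsSolutionCurve Ω α μ Φ p) (hΩ : IsCompact Ω) (ht : t ∈ Icc (0 : ℝ) 1)
    {g : EuclideanSpace ℝ (Fin d) → ℝ} (hg : ContinuousOn g Ω) :
    ∫ x in Ω, Φ t x * g x = inner ℝ (load Ω (restrictLp Ω 2 g)) (p t) := by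
  rw [inner_load]
  refine integral_congr_ae ?_
  filter_upwards [h.value_eq t ht, coeFn_restrictLp (p := 2) hΩ hg] with x h1 h2
  rw [h1, h2, mul_comm]

lemma integral_sq_mul (h : IsSolutionCurve Ω α μ Φ p) (hΩ : IsCompact Ω)
    (ht : t ∈ Icc (0 : ℝ) 1) {g : EuclideanSpace ℝ (Fin d) → ℝ} (hg : ContinuousOn g Ω) :
    ∫ x in Ω, ‖weakGradient Ω (Φ t) x‖ ^ 2 * g x =
      inner ℝ (gradForm Ω (restrictLp Ω ⊤ g) (p t)) (p t) := by
  rw [inner_gradForm]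
  refine integral_congr_ae ?_
  filter_upwards [h.grad_eq t ht, coeFn_restrictLp (p := ⊤) hΩ hg] with x h1 h2
  rw [h1, h2, real_inner_self_eq_norm_sq, mul_comm]

lemma continuousOn_integral_mul (h : IsSolutionCurve Ω α μ Φ p) (hΩ : IsCompact Ω)
    (hf : ContinuousOn (fun p : ℝ × EuclideanSpace ℝ (Fin d) => f p.1 p.2) (Icc 0 1 ×ˢ Ω)) :
    ContinuousOn (fun t => ∫ x in Ω, Φ t x * f t x) (Icc 0 1) := by
  refine ContinuousOn.congr ?_ fun t ht => h.integral_mul hΩ ht (hf.slice ht)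
  exact ((load Ω).continuous.comp_continuousOn (continuousOn_restrictLp hΩ 2 hf)).inner
    h.continuousOn

lemma continuousOn_integral_sq_mul (h : IsSolutionCurve Ω α μ Φ p) (hΩ : IsCompact Ω)
    (hf : ContinuousOn (fun p : ℝ × EuclideanSpace ℝ (Fin d) => f p.1 p.2) (Icc 0 1 ×ˢ Ω)) :
    ContinuousOn (fun t => ∫ x in Ω, ‖weakGradient Ω (Φ t) x‖ ^ 2 * f t x) (Icc 0 1) := by
  refine ContinuousOn.congr ?_ fun t ht => h.integral_sq_mul hΩ ht (hf.slice ht)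
  exact (((gradForm Ω).continuous.comp_continuousOn (continuousOn_restrictLp hΩ ⊤ hf)).clm_apply
    h.continuousOn).inner h.continuousOn

lemma memLp (h : IsSolutionCurve Ω α μ Φ p) (ht : t ∈ Icc (0 : ℝ) 1) :
    MemLp (Φ t) 2 (volume.restrict Ω) :=
  (memLp_congr_ae (h.value_eq t ht)).1 (Lp.memLp _)

lemma integrable (h : IsSolutionCurve Ω α μ Φ p) (hΩ : IsCompact Ω) (ht : t ∈ Icc (0 : ℝ) 1) :
    Integrable (Φ t) (volume.restrict Ω) := by
  have : IsFiniteMeasure (volume.restrict Ω) := ⟨by simpa using hΩ.measure_lt_top⟩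
  exact (h.memLp ht).integrable (by norm_num)

lemma integrable_sq (h : IsSolutionCurve Ω α μ Φ p) (ht : t ∈ Icc (0 : ℝ) 1) :
    Integrable (fun x => ‖weakGradient Ω (Φ t) x‖ ^ 2) (volume.restrict Ω) := by
  have := (memLp_congr_ae (h.grad_eq t ht)).1 (Lp.memLp _)
  exact this.integrable_norm_pow (by norm_num)

lemma isH1 (h : IsSolutionCurve Ω α μ Φ p) (ht : t ∈ Icc (0 : ℝ) 1) :
    IsH1 Ω (Φ t) (weakGradient Ω (Φ t)) :=
  (SobolevH1.isH1 (p t)).congr_ae (h.value_eq t ht).symm (h.grad_eq t ht).symm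

end IsSolutionCurve

/-- Uniqueness of the resolvent: the representative chosen in `ellipticResolvent` agrees almost
everywhere with `Φ t`. -/
lemma energy_eq_integral {α : ℝ} {μ Φ : ℝ → EuclideanSpace ℝ (Fin d) → ℝ} (hΩ : IsCompact Ω) (hconv : Convex ℝ Ω)
    (hne : (interior Ω).Nonempty) (hμ : IsPositivePath Ω μ) (hα : 0 < α)
    (hΦ : ∀ t ∈ Icc (0 : ℝ) 1, IsResolvent Ω α (μ t) (timeDeriv μ t) (Φ t)) :
    energy Ω α μ = ∫ t in (0 : ℝ)..1, ∫ x in Ω, timeDeriv μ t x * Φ t x := by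
  refine intervalIntegral.integral_congr fun t ht => ?_
  rw [uIcc_of_le zero_le_one] at ht
  obtain ⟨u, hu, huniq⟩ := hμ.exists_isResolvent hΩ hconv hne hα ht
  have hres : ellipticResolvent Ω α (μ t) (timeDeriv μ t) =ᵐ[volume.restrict Ω] Φ t := by
    have hex : ∃ u, IsResolvent Ω α (μ t) (timeDeriv μ t) u := ⟨u, hu⟩
    rw [ellipticResolvent, dif_pos hex]
    exact (huniq _ hex.choose_spec).trans (huniq _ (hΦ t ht)).symm
  exact integral_congr_ae (by filter_upwards [hres] with x hx; rw [hx])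

end Paths

/-! ### The first variation of the energy. -/

section FirstVariation

variable {d : ℕ} {Ω : Set (EuclideanSpace ℝ (Fin d))}

open SobolevH1

lemma hasDerivWithinAt_add_mul {μ η : ℝ → EuclideanSpace ℝ (Fin d) → ℝ} (hμ : IsPositivePath Ω μ)
    (hη : IsPerturbation Ω η) (h : ℝ)
    {t : ℝ} (ht : t ∈ Icc (0 : ℝ) 1) {x : EuclideanSpace ℝ (Fin d)} (hx : x ∈ Ω) :
    HasDerivWithinAt (fun s => μ s x + h * η s x) (timeDeriv μ t x + h * timeDeriv η t x)
      (Icc 0 1) t := by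
  refine (hμ.differentiable t ht x hx).hasDerivWithinAt.add (HasDerivWithinAt.const_mul h ?_)
  rw [hη.contDiffOn_one.timeDeriv_eq ht hx]
  exact hη.contDiffOn_one.hasDerivWithinAt_slice ht hx

lemma IsPositivePath.add_mul {μ η : ℝ → EuclideanSpace ℝ (Fin d) → ℝ} (hμ : IsPositivePath Ω μ)
    (hconv : Convex ℝ Ω) (hne : (interior Ω).Nonempty) (hη : IsPerturbation Ω η) {h : ℝ}
    (hpos : ∀ t ∈ Icc (0 : ℝ) 1, ∀ x ∈ Ω, 0 < μ t x + h * η t x) :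
    IsPositivePath Ω (fun t x => μ t x + h * η t x) where
  pos := hpos
  continuousOn := hμ.continuousOn.add (hη.continuousOn.const_mul h)
  differentiable t ht x hx :=
    (hasDerivWithinAt_add_mul hμ hη h ht hx).differentiableWithinAt
  continuousOn_timeDeriv := by
    refine (hμ.continuousOn_timeDeriv.add
      ((hη.contDiffOn_one.continuousOn_timeDeriv hconv hne).const_mul h)).congr fun p hp => ?_
    exact (hasDerivWithinAt_add_mul hμ hη h hp.1 hp.2).derivWithin
      (uniqueDiffOn_Icc zero_lt_one p.1 hp.1)

lemma hasDerivAt_of_abs_sub_le_sq {f : ℝ → ℝ} {D K δ : ℝ} (hδ : 0 < δ)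
    (h : ∀ s, |s| < δ → |f s - f 0 - s * D| ≤ K * s ^ 2) : HasDerivAt f D 0 := by
  rw [hasDerivAt_iff_isLittleO]
  have h1 : (fun x' => f x' - f 0 - (x' - 0) • D) =O[𝓝 0] fun x' : ℝ => x' ^ 2 := by
    refine Asymptotics.IsBigO.of_bound K ?_
    filter_upwards [Metric.ball_mem_nhds (0 : ℝ) hδ] with s hs
    have := h s (by simpa using hs)
    simpa [Real.norm_eq_abs, abs_of_nonneg (sq_nonneg s)] using this
  refine h1.trans_isLittleO ?_
  simpa using Asymptotics.isLittleO_pow_pow (𝕜 := ℝ) (m := 1) (n := 2) (by norm_num)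

/-- The abstract second-order estimate is applied at each time and integrated. Its error is uniform
in `t`, because `k' - B p` is continuous on `[0, 1]` and hence bounded by some `N`. -/
lemma IsSolutionCurve.hasFirstVariation (hΩ : IsCompact Ω) (hconv : Convex ℝ Ω)
    (hne : (interior Ω).Nonempty) {μ Φ η : ℝ → EuclideanSpace ℝ (Fin d) → ℝ} {α : ℝ}
    {p : ℝ → SobolevH1 Ω} (hp : IsSolutionCurve Ω α μ Φ p)
    (hμ : IsPositivePath Ω μ) (hα : 0 < α)
    (hΦ : ∀ t ∈ Icc (0 : ℝ) 1, IsResolvent Ω α (μ t) (timeDeriv μ t) (Φ t))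
    (hη : IsPerturbation Ω η) :
    HasFirstVariation Ω α μ η (∫ t in (0 : ℝ)..1,
      (2 * (∫ x in Ω, Φ t x * timeDeriv η t x) -
        ∫ x in Ω, ‖weakGradient Ω (Φ t) x‖ ^ 2 * η t x)) := by
  obtain ⟨c, hc, hcα, hcμ⟩ := hμ.exists_lower_bound hΩ hne hα
  have hηc := hη.continuousOn
  have hηt := hη.contDiffOn_one.continuousOn_timeDeriv hconv hne
  obtain ⟨M, hM⟩ := (isCompact_Icc.prod hΩ).exists_bound_of_continuousOn hηc
  set B : ℝ → SobolevH1 Ω →L[ℝ] SobolevH1 Ω := fun t => gradForm Ω (restrictLp Ω ⊤ (η t)) with hB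
  set k' : ℝ → SobolevH1 Ω := fun t => load Ω (restrictLp Ω 2 (timeDeriv η t)) with hk'
  have hBc : ContinuousOn B (Icc 0 1) :=
    (gradForm Ω).continuous.comp_continuousOn (continuousOn_restrictLp hΩ ⊤ hηc)
  have hkc : ContinuousOn k' (Icc 0 1) :=
    (load Ω).continuous.comp_continuousOn (continuousOn_restrictLp hΩ 2 hηt)
  obtain ⟨N, hN⟩ := isCompact_Icc.exists_bound_of_continuousOn
    (hkc.sub (hBc.clm_apply hp.continuousOn))
  have hcontD : ContinuousOn (fun t => 2 * (∫ x in Ω, Φ t x * timeDeriv η t x) -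
      ∫ x in Ω, ‖weakGradient Ω (Φ t) x‖ ^ 2 * η t x) (Icc 0 1) :=
    ((hp.continuousOn_integral_mul hΩ hηt).const_mul 2).sub
      (hp.continuousOn_integral_sq_mul hΩ hηc)
  have hE0 : ∀ (ν Ψ : ℝ → EuclideanSpace ℝ (Fin d) → ℝ) (q : ℝ → SobolevH1 Ω),
      IsSolutionCurve Ω α ν Ψ q → IsPositivePath Ω ν →
      IntervalIntegrable (fun t => ∫ x in Ω, timeDeriv ν t x * Ψ t x) volume 0 1 := by
    intro ν Ψ q hq hν
    refine ContinuousOn.intervalIntegrable ?_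
    rw [uIcc_of_le zero_le_one]
    simpa only [mul_comm] using hq.continuousOn_integral_mul hΩ hν.continuousOn_timeDeriv
  -- For `|h| < δ` the perturbation `h η` is at most `c / 2` in absolute value. The perturbed path
  -- then stays above `c / 2`, which is the coercivity constant in the error bound.
  refine hasDerivAt_of_abs_sub_le_sq (δ := c / 2 / (|M| + 1)) (K := N ^ 2 / (c / 2))
    (by positivity) fun h hh => ?_
  have hlow : ∀ t ∈ Icc (0 : ℝ) 1, ∀ x ∈ Ω, c / 2 ≤ μ t x + h * η t x := by
    intro t ht x hx
    have h1 := hcμ t ht x hx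
    have h2 : |h * η t x| ≤ c / 2 := by
      rw [abs_mul]
      have h3 : |η t x| ≤ |M| + 1 := by
        have h4 : |η t x| ≤ M := hM (t, x) ⟨ht, hx⟩
        have h5 := le_abs_self M
        linarith
      calc |h| * |η t x| ≤ c / 2 / (|M| + 1) * (|M| + 1) := by gcongr
        _ = c / 2 := by field_simp
    have := neg_le_of_abs_le h2
    linarith
  have hμh : IsPositivePath Ω (fun t x => μ t x + h * η t x) :=
    hμ.add_mul hconv hne hη fun t ht x hx => (half_pos hc).trans_le (hlow t ht x hx)
  have hex : ∀ t, ∃ u, t ∈ Icc (0 : ℝ) 1 → IsResolvent Ω α (fun x => μ t x + h * η t x)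
      (timeDeriv (fun t x => μ t x + h * η t x) t) u := by
    intro t
    by_cases ht : t ∈ Icc (0 : ℝ) 1
    · obtain ⟨u, hu, -⟩ := hμh.exists_isResolvent hΩ hconv hne hα ht
      exact ⟨u, fun _ => hu⟩
    · exact ⟨0, fun h => absurd h ht⟩
  choose Ψ hΨ using hex
  obtain ⟨q, hq⟩ := exists_isSolutionCurve hΩ hconv hne hμh hα hΨ
  have hzero : energy Ω α (fun t x => μ t x + 0 * η t x) = energy Ω α μ := by simp
  beta_reduce
  rw [hzero, energy_eq_integral hΩ hconv hne hμ hα hΦ, energy_eq_integral hΩ hconv hne hμh hα hΨ,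
    ← intervalIntegral.integral_const_mul, ← intervalIntegral.integral_sub (hE0 _ _ _ hq hμh)
      (hE0 _ _ _ hp hμ), ← intervalIntegral.integral_sub
      ((hE0 _ _ _ hq hμh).sub (hE0 _ _ _ hp hμ))
      (ContinuousOn.intervalIntegrable (by
        rw [uIcc_of_le zero_le_one]
        exact hcontD.const_mul h)), ← Real.norm_eq_abs]
  have hfin := intervalIntegral.norm_integral_le_of_norm_le_const (a := 0) (b := 1)
    (C := N ^ 2 / (c / 2) * h ^ 2) (f := fun t =>
      (∫ x in Ω, timeDeriv (fun t x => μ t x + h * η t x) t x * Ψ t x) -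
      (∫ x in Ω, timeDeriv μ t x * Φ t x) - h * (2 * (∫ x in Ω, Φ t x * timeDeriv η t x) -
        ∫ x in Ω, ‖weakGradient Ω (Φ t) x‖ ^ 2 * η t x)) ?_
  · simpa using hfin
  intro t ht
  rw [uIoc_of_le zero_le_one] at ht
  replace ht : t ∈ Icc (0 : ℝ) 1 := Ioc_subset_Icc_self ht
  have hdt : ∀ x ∈ Ω, timeDeriv (fun t x => μ t x + h * η t x) t x =
      timeDeriv μ t x + h * timeDeriv η t x := fun x hx =>
    (hasDerivWithinAt_add_mul hμ hη h ht hx).derivWithin (uniqueDiffOn_Icc zero_lt_one t ht)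
  have hρ : ellipticOp Ω α (restrictLp Ω ⊤ (fun x => μ t x + h * η t x)) =
      ellipticOp Ω α (restrictLp Ω ⊤ (μ t)) + h • B t := by
    rw [restrictLp_congr_add_smul hΩ (hμ.continuousOn.slice ht) (hηc.slice ht) fun _ _ => rfl,
      ellipticOp_add_smul]
  have hk : load Ω (restrictLp Ω 2 (timeDeriv (fun t x => μ t x + h * η t x) t)) =
      load Ω (restrictLp Ω 2 (timeDeriv μ t)) + h • k' t := by
    rw [restrictLp_congr_add_smul hΩ (hμ.continuousOn_timeDeriv.slice ht) (hηt.slice ht) hdt,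
      map_add, map_smul]
  have hcoer := ellipticOp_coercive (show c / 2 ≤ α by linarith)
    (ae_le_restrictLp (p := ⊤) (f := fun x => μ t x + h * η t x) hΩ
      (ContinuousOn.slice (f := fun t x => μ t x + h * η t x) hμh.continuousOn ht) (hlow t ht))
  have hsymm := ellipticOp_symm α (restrictLp Ω ⊤ (fun x => μ t x + h * η t x))
  have hqeq := hq.eq t ht
  rw [hρ] at hcoer hsymm hqeq
  rw [hk] at hqeq
  have key := abs_inner_sub_le_of_coercive (half_pos hc) hcoer hsymm (hp.eq t ht) hqeq
  rw [← hk, ← hq.integral_mul hΩ ht (hμh.continuousOn_timeDeriv.slice ht),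
    ← hp.integral_mul hΩ ht (hμ.continuousOn_timeDeriv.slice ht),
    ← hp.integral_mul hΩ ht (hηt.slice ht), ← hp.integral_sq_mul hΩ ht (hηc.slice ht)] at key
  rw [Real.norm_eq_abs]
  simp only [mul_comm (timeDeriv _ _ _) (Φ _ _), mul_comm (timeDeriv _ _ _) (Ψ _ _)]
  refine key.trans ?_
  have hNt : ‖k' t - B t (p t)‖ ≤ N := hN t ht
  calc h ^ 2 / (c / 2) * ‖k' t - B t (p t)‖ ^ 2 ≤ h ^ 2 / (c / 2) * N ^ 2 := by gcongr
    _ = N ^ 2 / (c / 2) * h ^ 2 := by ring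

end FirstVariation

/-! ### Cut-offs and approximation by test functions. -/

section Cutoff

variable {d : ℕ} {Ω : Set (EuclideanSpace ℝ (Fin d))}

lemma deriv_smoothTransition_eq_zero {s : ℝ} (hs : s < 0 ∨ 1 < s) :
    deriv Real.smoothTransition s = 0 := by
  rcases hs with hs | hs
  · have : Real.smoothTransition =ᶠ[𝓝 s] fun _ => 0 := by
      filter_upwards [Iio_mem_nhds hs] with y hy
      exact Real.smoothTransition.zero_of_nonpos (le_of_lt hy)
    rw [this.deriv_eq, deriv_const]
  · have : Real.smoothTransition =ᶠ[𝓝 s] fun _ => 1 := by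
      filter_upwards [Ioi_mem_nhds hs] with y hy
      exact Real.smoothTransition.one_of_one_le (le_of_lt hy)
    rw [this.deriv_eq, deriv_const]

/-- The weight `s + 1` becomes `N t` at `s = N t - 1`. The bound thus controls `t` times the
derivative of `scaledTransition N`, uniformly in `N`. -/
lemma exists_bound_deriv_smoothTransition :
    ∃ L, ∀ s : ℝ, |(s + 1) * deriv Real.smoothTransition s| ≤ L := by
  have hc : Continuous fun s : ℝ => (s + 1) * deriv Real.smoothTransition s :=
    (continuous_id.add continuous_const).mul
      ((Real.smoothTransition.contDiff (n := 1)).continuous_deriv le_rfl)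
  have hs : HasCompactSupport fun s : ℝ => (s + 1) * deriv Real.smoothTransition s := by
    refine HasCompactSupport.intro (isCompact_Icc (a := (0 : ℝ)) (b := 1)) fun s hs => ?_
    rw [deriv_smoothTransition_eq_zero, mul_zero]
    by_contra! hcon
    exact hs hcon
  exact hc.bounded_above_of_compact_support hs

/-- A smooth function of `s` that vanishes for `N s ≤ 1` and equals `1` for `2 ≤ N s`. -/
def scaledTransition (N s : ℝ) : ℝ := Real.smoothTransition (N * s - 1)

lemma scaledTransition_contDiff (N : ℝ) : ContDiff ℝ ∞ (scaledTransition N) :=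
  Real.smoothTransition.contDiff.comp ((contDiff_const.mul contDiff_id).sub contDiff_const)

lemma scaledTransition_hasDerivAt (N s : ℝ) :
    HasDerivAt (scaledTransition N) (N * deriv Real.smoothTransition (N * s - 1)) s := by
  have h1 : HasDerivAt Real.smoothTransition (deriv Real.smoothTransition (N * s - 1))
      (N * s - 1) :=
    ((Real.smoothTransition.contDiff (n := 1)).differentiable one_ne_zero _).hasDerivAt
  have h2 : HasDerivAt (fun s : ℝ => N * s - 1) N s := by
    simpa using ((hasDerivAt_id s).const_mul N).sub_const 1
  exact (h1.comp s h2).congr_deriv (mul_comm _ _)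

lemma scaledTransition_nonneg (N s : ℝ) : 0 ≤ scaledTransition N s :=
  Real.smoothTransition.nonneg _

lemma scaledTransition_le_one (N s : ℝ) : scaledTransition N s ≤ 1 :=
  Real.smoothTransition.le_one _

lemma scaledTransition_ne_zero {N s : ℝ} (h : scaledTransition N s ≠ 0) : 1 ≤ N * s := by
  by_contra! hcon
  exact h (Real.smoothTransition.zero_of_nonpos (by linarith))

lemma eventually_scaledTransition {s : ℝ} (hs : 0 < s) : ∀ᶠ n : ℕ in atTop,
    scaledTransition (n + 1) s = 1 ∧ deriv Real.smoothTransition ((n + 1) * s - 1) = 0 := by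
  have h1 : Tendsto (fun n : ℕ => ((n : ℝ) + 1) * s - 1) atTop atTop :=
    tendsto_atTop_add_const_right _ _ ((tendsto_atTop_add_const_right _ _
      tendsto_natCast_atTop_atTop).atTop_mul_const hs)
  filter_upwards [h1.eventually_gt_atTop 1] with n hn
  exact ⟨Real.smoothTransition.one_of_one_le hn.le, deriv_smoothTransition_eq_zero (Or.inr hn)⟩

/-- The time cut-off `θ(t) = τ(t) τ(1 - t)`. -/
def timeCutoff (N t : ℝ) : ℝ := scaledTransition N t * scaledTransition N (1 - t)

/-- The derivative of `timeCutoff N`. -/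
def timeCutoffDeriv (N t : ℝ) : ℝ :=
  N * deriv Real.smoothTransition (N * t - 1) * scaledTransition N (1 - t) -
    scaledTransition N t * (N * deriv Real.smoothTransition (N * (1 - t) - 1))

lemma timeCutoff_hasDerivAt (N t : ℝ) : HasDerivAt (timeCutoff N) (timeCutoffDeriv N t) t := by
  have h1 : HasDerivAt (fun t : ℝ => 1 - t) (-1) t := by
    simpa using (hasDerivAt_id t).const_sub 1
  have h2 := (scaledTransition_hasDerivAt N (1 - t)).comp t h1
  have h3 := (scaledTransition_hasDerivAt N t).mul h2
  refine h3.congr_deriv ?_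
  simp only [timeCutoffDeriv, Function.comp_apply]
  ring

lemma timeCutoff_contDiff (N : ℝ) : ContDiff ℝ ∞ (timeCutoff N) :=
  (scaledTransition_contDiff N).mul
    ((scaledTransition_contDiff N).comp (contDiff_const.sub contDiff_id))

lemma abs_timeCutoff_le_one (N t : ℝ) : |timeCutoff N t| ≤ 1 := by
  rw [timeCutoff, abs_of_nonneg (mul_nonneg (scaledTransition_nonneg _ _)
    (scaledTransition_nonneg _ _))]
  exact mul_le_one₀ (scaledTransition_le_one _ _) (scaledTransition_nonneg _ _)
    (scaledTransition_le_one _ _)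

/-- Here `y` stands for `η t x`. The derivative of the cut-off is of size `N`, but it lives where
`t` or `1 - t` is of order `1 / N`, and there `y` is of that order too. -/
lemma abs_timeCutoffDeriv_mul_le {L : ℝ}
    (hL : ∀ s : ℝ, |(s + 1) * deriv Real.smoothTransition s| ≤ L) {N t y M : ℝ} (hN : 0 ≤ N)
    (ht : t ∈ Icc (0 : ℝ) 1) (h0 : |y| ≤ M * t) (h1 : |y| ≤ M * (1 - t)) (hM : 0 ≤ M) :
    |timeCutoffDeriv N t * y| ≤ 2 * (L * M) := by
  have key : ∀ s : ℝ, 0 ≤ s → |y| ≤ M * s →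
      |N * deriv Real.smoothTransition (N * s - 1) * y| ≤ L * M := by
    intro s hs hy
    have h2 := hL (N * s - 1)
    rw [sub_add_cancel, abs_mul, abs_of_nonneg (mul_nonneg hN hs)] at h2
    calc |N * deriv Real.smoothTransition (N * s - 1) * y|
        = N * |deriv Real.smoothTransition (N * s - 1)| * |y| := by
          rw [abs_mul, abs_mul, abs_of_nonneg hN]
      _ ≤ N * |deriv Real.smoothTransition (N * s - 1)| * (M * s) := by gcongr
      _ = N * s * |deriv Real.smoothTransition (N * s - 1)| * M := by ring
      _ ≤ L * M := by gcongr
  have k0 := key t ht.1 h0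
  have k1 := key (1 - t) (by linarith [ht.2]) h1
  have e : timeCutoffDeriv N t * y =
      scaledTransition N (1 - t) * (N * deriv Real.smoothTransition (N * t - 1) * y) -
      scaledTransition N t * (N * deriv Real.smoothTransition (N * (1 - t) - 1) * y) := by
    rw [timeCutoffDeriv]; ring
  have hmul : ∀ a b : ℝ, 0 ≤ a → a ≤ 1 → |a * b| ≤ |b| := by
    intro a b ha ha1
    rw [abs_mul, abs_of_nonneg ha]
    exact mul_le_of_le_one_left (abs_nonneg _) ha1
  rw [e]
  refine (abs_sub _ _).trans ?_
  have m0 := (hmul _ (N * deriv Real.smoothTransition (N * t - 1) * y)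
    (scaledTransition_nonneg N (1 - t)) (scaledTransition_le_one N (1 - t))).trans k0
  have m1 := (hmul _ (N * deriv Real.smoothTransition (N * (1 - t) - 1) * y)
    (scaledTransition_nonneg N t) (scaledTransition_le_one N t)).trans k1
  linarith

lemma eventually_timeCutoff {t : ℝ} (ht : t ∈ Ioo (0 : ℝ) 1) : ∀ᶠ n : ℕ in atTop,
    timeCutoff (n + 1) t = 1 ∧ timeCutoffDeriv (n + 1) t = 0 := by
  filter_upwards [eventually_scaledTransition ht.1,
    eventually_scaledTransition (sub_pos.2 ht.2)] with n h1 h2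
  simp [timeCutoff, timeCutoffDeriv, h1.1, h1.2, h2.1, h2.2]

/-- Smooth functions on `[0, 1] × Ω` vanishing at `t = 0, 1` are limits, boundedly and pointwise in
the interior and together with their time derivatives, of test functions. -/
lemma exists_testFunction_approx (hΩ : IsCompact Ω) (hconv : Convex ℝ Ω)
    (hne : (interior Ω).Nonempty) {η : ℝ → EuclideanSpace ℝ (Fin d) → ℝ}
    (hη : IsPerturbation Ω η) (hend : FixesEndpoints Ω η) :
    ∃ (F : ℕ → ℝ → EuclideanSpace ℝ (Fin d) → ℝ) (C : ℝ),
      (∀ n, ContDiff ℝ ∞ (fun p : ℝ × EuclideanSpace ℝ (Fin d) => F n p.1 p.2) ∧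
        HasCompactSupport (fun p : ℝ × EuclideanSpace ℝ (Fin d) => F n p.1 p.2) ∧
        tsupport (fun p : ℝ × EuclideanSpace ℝ (Fin d) => F n p.1 p.2) ⊆
          Ioo 0 1 ×ˢ interior Ω) ∧
      (∀ n, ∀ t ∈ Icc (0 : ℝ) 1, ∀ x ∈ Ω, |F n t x| ≤ C ∧ |timeDeriv (F n) t x| ≤ C) ∧
      ∀ t ∈ Ioo (0 : ℝ) 1, ∀ x ∈ interior Ω,
        Tendsto (fun n => F n t x) atTop (𝓝 (η t x)) ∧
        Tendsto (fun n => timeDeriv (F n) t x) atTop (𝓝 (timeDeriv η t x)) := by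
  -- A smooth `g ≥ 0` that is positive exactly on `interior Ω`: its sets `1 ≤ N g` are closed and
  -- exhaust the interior, so `scaledTransition N ∘ g` is a spatial cut-off.
  obtain ⟨g, hgs, hg, hg01⟩ := IsOpen.exists_contDiff_support_eq (n := ⊤)
    (isOpen_interior (s := Ω))
  have hgpos : ∀ x, 0 < g x → x ∈ interior Ω := fun x hx => by
    rw [← hgs]; exact hx.ne'
  have hgpos' : ∀ x ∈ interior Ω, 0 < g x := fun x hx =>
    lt_of_le_of_ne (hg01 ⟨x, rfl⟩).1 (Ne.symm (by rw [← hgs] at hx; exact hx))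
  have hηc := hη.continuousOn
  have hη1 := hη.contDiffOn_one
  obtain ⟨M, hM⟩ := (isCompact_Icc.prod hΩ).exists_bound_of_continuousOn hηc
  obtain ⟨M', hM'⟩ := (isCompact_Icc.prod hΩ).exists_bound_of_continuousOn
    (hη1.continuousOn_timeDeriv hconv hne)
  obtain ⟨L, hL⟩ := exists_bound_deriv_smoothTransition
  have hderiv : ∀ t ∈ Icc (0 : ℝ) 1, ∀ x ∈ Ω,
      HasDerivWithinAt (fun s => η s x) (timeDeriv η t x) (Icc 0 1) t := by
    intro t ht x hx
    rw [hη1.timeDeriv_eq ht hx]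
    exact hη1.hasDerivWithinAt_slice ht hx
  -- Combined with the vanishing at `t = 0, 1`, this gives `|η t x| ≤ M' t` and `|η t x| ≤ M' (1 -
  -- t)`.
  have hlip : ∀ x ∈ Ω, ∀ s ∈ Icc (0 : ℝ) 1, ∀ t ∈ Icc (0 : ℝ) 1,
      |η t x - η s x| ≤ M' * |t - s| := fun x hx s hs t ht =>
    (convex_Icc (0 : ℝ) 1).norm_image_sub_le_of_norm_hasDerivWithin_le
      (fun r hr => hderiv r hr x hx) (fun r hr => hM' (r, x) ⟨hr, hx⟩) hs ht
  set F : ℕ → ℝ → EuclideanSpace ℝ (Fin d) → ℝ := fun n t x =>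
    timeCutoff (n + 1) t * η t x * scaledTransition (n + 1) (g x) with hF
  have htime : ∀ n, ∀ t ∈ Icc (0 : ℝ) 1, ∀ x ∈ Ω, timeDeriv (F n) t x =
      (timeCutoffDeriv (n + 1) t * η t x + timeCutoff (n + 1) t * timeDeriv η t x) *
        scaledTransition (n + 1) (g x) := by
    intro n t ht x hx
    exact (((timeCutoff_hasDerivAt (n + 1) t).hasDerivWithinAt.mul
      (hderiv t ht x hx)).mul_const _).derivWithin (uniqueDiffOn_Icc zero_lt_one t ht)
  have hsub : ∀ n, tsupport (fun p : ℝ × EuclideanSpace ℝ (Fin d) => F n p.1 p.2) ⊆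
      Ioo 0 1 ×ˢ interior Ω := by
    intro n
    have hN : (0 : ℝ) < n + 1 := by positivity
    have hclosed : IsClosed {p : ℝ × EuclideanSpace ℝ (Fin d) | 1 ≤ ((n : ℝ) + 1) * p.1 ∧
        1 ≤ ((n : ℝ) + 1) * (1 - p.1) ∧ 1 ≤ ((n : ℝ) + 1) * g p.2} := by
      have hgc := hg.continuous
      simp only [ofPred_and]
      refine (isClosed_le continuous_const ?_).inter
        ((isClosed_le continuous_const ?_).inter (isClosed_le continuous_const ?_)) <;> fun_prop
    -- Nonzero values force all three factors to satisfy a closed inequality with margin `1 / (n +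
    -- 1)`, so taking the closure of the support does not leave the open cylinder.
    refine (closure_minimal ?_ hclosed).trans ?_
    · rintro ⟨t, x⟩ hp
      have h1 : F n t x ≠ 0 := hp
      simp only [hF, timeCutoff, mul_ne_zero_iff] at h1
      exact ⟨scaledTransition_ne_zero h1.1.1.1, scaledTransition_ne_zero h1.1.1.2,
        scaledTransition_ne_zero h1.2⟩
    · rintro ⟨t, x⟩ ⟨h1, h2, h3⟩
      have hp : ∀ s : ℝ, 1 ≤ ((n : ℝ) + 1) * s → 0 < s := fun s hs =>
        pos_of_mul_pos_right (zero_lt_one.trans_le hs) hN.le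
      exact ⟨⟨hp _ h1, by linarith [hp _ h2]⟩, hgpos _ (hp _ h3)⟩
  have hbox : Ioo (0 : ℝ) 1 ×ˢ interior Ω ⊆ Icc (0 : ℝ) 1 ×ˢ Ω :=
    prod_mono Ioo_subset_Icc_self interior_subset
  refine ⟨F, max M (2 * (L * M') + M'), fun n => ⟨?_, ?_, hsub n⟩, ?_, ?_⟩
  · refine contDiff_iff_contDiffAt.2 fun p => ?_
    -- `η` is only controlled on the cylinder. Off the topological support `F n` is locally zero,
    -- and on it the cylinder is a neighbourhood of `p`.
    by_cases hp : p ∈ tsupport (fun p : ℝ × EuclideanSpace ℝ (Fin d) => F n p.1 p.2)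
    swap
    · refine (contDiffAt_const (c := (0 : ℝ))).congr_of_eventuallyEq ?_
      exact notMem_tsupport_iff_eventuallyEq.1 hp
    have hp' := hsub n hp
    have hnhds : Icc (0 : ℝ) 1 ×ˢ Ω ∈ 𝓝 p :=
      mem_of_superset ((isOpen_Ioo.prod isOpen_interior).mem_nhds hp') hbox
    have h1 : ContDiffAt ℝ ∞ (fun p : ℝ × EuclideanSpace ℝ (Fin d) => η p.1 p.2) p :=
      ContDiffOn.contDiffAt hη hnhds
    have h2 : ContDiff ℝ ∞ (fun p : ℝ × EuclideanSpace ℝ (Fin d) => timeCutoff (n + 1) p.1) :=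
      (timeCutoff_contDiff _).comp contDiff_fst
    have h3 : ContDiff ℝ ∞ (fun p : ℝ × EuclideanSpace ℝ (Fin d) =>
        scaledTransition (n + 1) (g p.2)) :=
      (scaledTransition_contDiff _).comp (hg.comp contDiff_snd)
    exact (h2.contDiffAt.mul h1).mul h3.contDiffAt
  · exact (isCompact_Icc.prod hΩ).of_isClosed_subset (isClosed_tsupport _) ((hsub n).trans hbox)
  · intro n t ht x hx
    have hM0 : |η t x| ≤ M := hM (t, x) ⟨ht, hx⟩
    have hM1 : |timeDeriv η t x| ≤ M' := hM' (t, x) ⟨ht, hx⟩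
    have hM'0 : 0 ≤ M' := (abs_nonneg _).trans hM1
    have hsc : ∀ y : ℝ, |y * scaledTransition (n + 1) (g x)| ≤ |y| := fun y => by
      rw [abs_mul, abs_of_nonneg (scaledTransition_nonneg _ _)]
      exact mul_le_of_le_one_right (abs_nonneg _) (scaledTransition_le_one _ _)
    have htc : ∀ y : ℝ, |timeCutoff (n + 1) t * y| ≤ |y| := fun y => by
      rw [abs_mul]
      exact mul_le_of_le_one_left (abs_nonneg _) (abs_timeCutoff_le_one _ _)
    refine ⟨((hsc _).trans ((htc _).trans hM0)).trans (le_max_left _ _), ?_⟩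
    rw [htime n t ht x hx]
    refine ((hsc _).trans ((abs_add_le _ _).trans (add_le_add ?_ ((htc _).trans hM1)))).trans
      (le_max_right _ _)
    refine abs_timeCutoffDeriv_mul_le hL (by positivity) ht ?_ ?_ hM'0
    · have := hlip x hx 0 (left_mem_Icc.2 zero_le_one) t ht
      rwa [(hend x hx).1, sub_zero, sub_zero, abs_of_nonneg ht.1] at this
    · have := hlip x hx 1 (right_mem_Icc.2 zero_le_one) t ht
      rwa [(hend x hx).2, sub_zero, abs_sub_comm, abs_of_nonneg (sub_nonneg.2 ht.2)] at this
  · intro t ht x hx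
    -- At a fixed interior point all cut-offs equal `1` and the derivative of the time cut-off
    -- vanishes from some `n` on, so the sequences are eventually constant.
    have hev : ∀ᶠ n : ℕ in atTop, F n t x = η t x ∧ timeDeriv (F n) t x = timeDeriv η t x := by
      filter_upwards [eventually_timeCutoff ht, eventually_scaledTransition (hgpos' x hx)]
        with n h1 h2
      rw [htime n t (Ioo_subset_Icc_self ht) x (interior_subset hx)]
      simp [hF, h1.1, h1.2, h2.1]
    exact ⟨tendsto_const_nhds.congr' (hev.mono fun n hn => hn.1.symm),
      tendsto_const_nhds.congr' (hev.mono fun n hn => hn.2.symm)⟩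

/-- Dominated convergence for iterated integrals against a weight `w t`, without joint
measurability of `w`. -/
lemma tendsto_integral_integral_mul (hΩ : IsCompact Ω) (hconv : Convex ℝ Ω)
    {w : ℝ → EuclideanSpace ℝ (Fin d) → ℝ} {K : ℝ}
    (hw : ∀ t ∈ Icc (0 : ℝ) 1, Integrable (w t) (volume.restrict Ω))
    (hK : ∀ t ∈ Icc (0 : ℝ) 1, ∫ x in Ω, |w t x| ≤ K)
    (hcont : ∀ f : ℝ → EuclideanSpace ℝ (Fin d) → ℝ,
      ContinuousOn (fun p : ℝ × EuclideanSpace ℝ (Fin d) => f p.1 p.2) (Icc 0 1 ×ˢ Ω) →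
      ContinuousOn (fun t => ∫ x in Ω, w t x * f t x) (Icc 0 1))
    {F : ℕ → ℝ → EuclideanSpace ℝ (Fin d) → ℝ} {f : ℝ → EuclideanSpace ℝ (Fin d) → ℝ} {C : ℝ}
    (hF : ∀ n, ContinuousOn (fun p : ℝ × EuclideanSpace ℝ (Fin d) => F n p.1 p.2) (Icc 0 1 ×ˢ Ω))
    (hC : ∀ n, ∀ t ∈ Icc (0 : ℝ) 1, ∀ x ∈ Ω, |F n t x| ≤ C)
    (hlim : ∀ t ∈ Ioo (0 : ℝ) 1, ∀ x ∈ interior Ω,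
      Tendsto (fun n => F n t x) atTop (𝓝 (f t x))) :
    Tendsto (fun n => ∫ t in (0 : ℝ)..1, ∫ x in Ω, w t x * F n t x) atTop
      (𝓝 (∫ t in (0 : ℝ)..1, ∫ x in Ω, w t x * f t x)) := by
  have hCw : ∀ n, ∀ t ∈ Icc (0 : ℝ) 1, ∀ᵐ x ∂(volume.restrict Ω),
      ‖w t x * F n t x‖ ≤ C * |w t x| := by
    intro n t ht
    filter_upwards [ae_restrict_mem hΩ.measurableSet] with x hx
    rw [norm_mul, mul_comm]
    exact mul_le_mul_of_nonneg_right (hC n t ht x hx) (abs_nonneg _)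
  have hI : uIoc (0 : ℝ) 1 ⊆ Icc 0 1 := by
    rw [uIoc_of_le zero_le_one]; exact Ioc_subset_Icc_self
  refine intervalIntegral.tendsto_integral_filter_of_dominated_convergence (fun _ => |C| * K)
    (Eventually.of_forall fun n => ?_) (Eventually.of_forall fun n => ?_) (by simp) ?_
  · exact ((hcont _ (hF n)).mono hI).aestronglyMeasurable measurableSet_uIoc
  · refine Eventually.of_forall fun t ht => ?_
    have ht' := hI ht
    refine (norm_integral_le_of_norm_le ((hw t ht').abs.const_mul C) (hCw n t ht')).trans ?_
    rw [integral_const_mul]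
    have h0 : 0 ≤ ∫ x in Ω, |w t x| := integral_nonneg fun _ => abs_nonneg _
    exact (mul_le_mul_of_nonneg_right (le_abs_self C) h0).trans
      (mul_le_mul_of_nonneg_left (hK t ht') (abs_nonneg C))
  · have h1 : ∀ᵐ t : ℝ, t ≠ 1 := by
      rw [ae_iff]; simp
    filter_upwards [h1] with t ht1 ht
    have ht' := hI ht
    rw [uIoc_of_le zero_le_one] at ht
    have hto : t ∈ Ioo (0 : ℝ) 1 := ⟨ht.1, lt_of_le_of_ne ht.2 ht1⟩
    refine tendsto_integral_of_dominated_convergence (fun x => C * |w t x|) (fun n => ?_)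
      ((hw t ht').abs.const_mul C) (fun n => hCw n t ht') ?_
    · exact (hw t ht').aestronglyMeasurable.mul
        (((hF n).slice ht').aestronglyMeasurable hΩ.measurableSet)
    · refine ae_restrict_of_ae_restrict_interior hconv (Eventually.of_forall fun x hx => ?_)
      exact (hlim t hto x hx).const_mul _

end Cutoff

/-! ### Uniform bounds for the weights in the dominated convergence. -/

section EulerLagrange

variable {d : ℕ} {Ω : Set (EuclideanSpace ℝ (Fin d))} {α : ℝ}
  {μ Φ : ℝ → EuclideanSpace ℝ (Fin d) → ℝ} {p : ℝ → SobolevH1 Ω}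

open SobolevH1

namespace IsSolutionCurve

/-- By `|a| ≤ 1 + a²` it suffices to bound the `L²` norm, which is continuous in `t`. -/
lemma exists_bound_integral_abs (h : IsSolutionCurve Ω α μ Φ p) (hΩ : IsCompact Ω) :
    ∃ K, ∀ t ∈ Icc (0 : ℝ) 1, ∫ x in Ω, |Φ t x| ≤ K := by
  have : IsFiniteMeasure (volume.restrict Ω) := ⟨by simpa using hΩ.measure_lt_top⟩
  obtain ⟨C, hC⟩ := isCompact_Icc.exists_bound_of_continuousOn
    (((value Ω).continuous.comp_continuousOn h.continuousOn).norm.pow 2)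
  refine ⟨(∫ x in Ω, (1 : ℝ)) + C, fun t ht => ?_⟩
  have hsq : Integrable (fun x => Φ t x ^ 2) (volume.restrict Ω) := (h.memLp ht).integrable_sq
  have e : ∫ x in Ω, Φ t x ^ 2 = ‖value Ω (p t)‖ ^ 2 := by
    rw [← real_inner_self_eq_norm_sq, L2.inner_def]
    refine integral_congr_ae ?_
    filter_upwards [h.value_eq t ht] with x hx
    rw [hx, real_inner_self_eq_norm_sq, Real.norm_eq_abs, sq_abs]
  calc ∫ x in Ω, |Φ t x| ≤ ∫ x in Ω, (1 + Φ t x ^ 2) := by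
        refine integral_mono (h.integrable hΩ ht).abs ((integrable_const 1).add hsq) fun x => ?_
        change |Φ t x| ≤ 1 + Φ t x ^ 2
        rw [← sq_abs]
        nlinarith [sq_nonneg (|Φ t x| - 1), abs_nonneg (Φ t x)]
    _ = (∫ x in Ω, (1 : ℝ)) + ‖value Ω (p t)‖ ^ 2 := by
        rw [integral_add (integrable_const 1) hsq, e]
    _ ≤ (∫ x in Ω, (1 : ℝ)) + C := by
        gcongr
        exact (le_abs_self _).trans (hC t ht)

lemma exists_bound_integral_sq (h : IsSolutionCurve Ω α μ Φ p) (hΩ : IsCompact Ω) :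
    ∃ K, ∀ t ∈ Icc (0 : ℝ) 1, ∫ x in Ω, |‖weakGradient Ω (Φ t) x‖ ^ 2| ≤ K := by
  obtain ⟨C, hC⟩ := isCompact_Icc.exists_bound_of_continuousOn
    (h.continuousOn_integral_sq_mul hΩ (f := fun _ _ => 1) continuousOn_const)
  refine ⟨C, fun t ht => ?_⟩
  have := (le_abs_self _).trans (hC t ht)
  simpa using this

end IsSolutionCurve

end EulerLagrange

/-! ### Integration by parts against compactly supported functions. -/

section IntegrationByParts

variable {F : Type*} [NormedAddCommGroup F] [NormedSpace ℝ F] {U : Set F} {u ψ : F → ℝ}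

lemma mul_eq_zero_of_notMem {X : Type*} [TopologicalSpace X] {U : Set X} {b : X → ℝ}
    (hs : tsupport b ⊆ U) {x : X} (hx : x ∉ U) (c : ℝ) : c * b x = 0 := by
  rw [image_eq_zero_of_notMem_tsupport fun h => hx (hs h), mul_zero]

lemma integrable_mul_of_tsupport_subset {X : Type*} [TopologicalSpace X] [T2Space X]
    [MeasurableSpace X] [BorelSpace X] {ν : Measure X} [IsFiniteMeasureOnCompacts ν] {U : Set X}
    {a b : X → ℝ} (ha : ContinuousOn a U) (hb : Continuous b)
    (hc : HasCompactSupport b) (hs : tsupport b ⊆ U) : Integrable (fun x => a x * b x) ν := by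
  have h1 : IntegrableOn (fun x => a x * b x) (tsupport b) ν :=
    ((ha.mono hs).mul hb.continuousOn).integrableOn_compact hc
  refine (integrableOn_iff_integrable_of_support_subset fun x hx => ?_).1 h1
  exact subset_tsupport b fun h0 => hx (by simp [h0])

variable [MeasurableSpace F] [BorelSpace F] [FiniteDimensional ℝ F] {ν : Measure F}
  [ν.IsAddHaarMeasure]

/-- The behaviour of `u` outside `U` is irrelevant: all products vanish off `tsupport ψ`, so its
derivative is needed only there. -/
lemma integral_mul_fderiv_eq_neg_of_tsupport_subset (hU : IsOpen U) (hu : ContDiffOn ℝ 1 u U)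
    (hψ : ContDiff ℝ ∞ ψ) (hc : HasCompactSupport ψ) (hs : tsupport ψ ⊆ U) (v : F) :
    ∫ x, u x * fderiv ℝ ψ x v ∂ν = -∫ x, fderiv ℝ u x v * ψ x ∂ν := by
  have hψ1 : Continuous fun x => fderiv ℝ ψ x v :=
    (hψ.continuous_fderiv (by simp)).clm_apply continuous_const
  have hu1 : ContinuousOn (fun x => fderiv ℝ u x v) U :=
    (hu.continuousOn_fderiv_of_isOpen hU le_rfl).clm_apply continuousOn_const
  have hs1 : tsupport (fun x => fderiv ℝ ψ x v) ⊆ U :=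
    (tsupport_fderiv_apply_subset ℝ _).trans hs
  refine integral_bilinear_hasLineDerivAt_right_eq_neg_left_of_integrable
    (B := ContinuousLinearMap.mul ℝ ℝ) (v := v)
    (integrable_mul_of_tsupport_subset hu1 hψ.continuous hc hs)
    (integrable_mul_of_tsupport_subset hu.continuousOn hψ1 (hc.fderiv_apply ℝ v) hs1)
    (integrable_mul_of_tsupport_subset hu.continuousOn hψ.continuous hc hs) ?_ ?_
  · intro x hx
    exact ((hu.contDiffAt (hU.mem_nhds (hs hx))).differentiableAt
      one_ne_zero).hasFDerivAt.hasLineDerivAt v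
  · intro x _
    exact (hψ.differentiable (by simp) x).hasFDerivAt.hasLineDerivAt v

end IntegrationByParts

/-! ### The weak and the pointwise Hamilton–Jacobi equation. -/

section HamiltonJacobi

variable {d : ℕ} {Ω : Set (EuclideanSpace ℝ (Fin d))}

instance : (volume : Measure (ℝ × EuclideanSpace ℝ (Fin d))).IsAddHaarMeasure := by
  rw [Measure.volume_eq_prod]
  infer_instance

lemma integral_integral_eq_integral_prod
    {k : ℝ × EuclideanSpace ℝ (Fin d) → ℝ} (hk : Integrable k)
    (h0 : ∀ p, p ∉ Ioo (0 : ℝ) 1 ×ˢ interior Ω → k p = 0) :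
    ∫ t in (0 : ℝ)..1, ∫ x in Ω, k (t, x) = ∫ p, k p := by
  rw [Measure.volume_eq_prod] at hk ⊢
  rw [integral_prod _ hk, intervalIntegral.integral_of_le zero_le_one]
  have h1 : ∀ t, ∫ x in Ω, k (t, x) = ∫ x, k (t, x) := fun t =>
    setIntegral_eq_integral_of_forall_compl_eq_zero fun x hx =>
      h0 _ fun hp => hx (interior_subset hp.2)
  simp only [h1]
  refine setIntegral_eq_integral_of_forall_compl_eq_zero fun t ht => ?_
  have : ∀ x, k (t, x) = 0 := fun x => h0 _ fun hp => ht (Ioo_subset_Ioc_self hp.1)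
  simp [this]

lemma DifferentiableAt.hasDerivAt_slice {f : ℝ → EuclideanSpace ℝ (Fin d) → ℝ} {t : ℝ}
    {x : EuclideanSpace ℝ (Fin d)}
    (hf : DifferentiableAt ℝ (fun p : ℝ × EuclideanSpace ℝ (Fin d) => f p.1 p.2) (t, x)) :
    HasDerivAt (fun s => f s x)
      (fderiv ℝ (fun p : ℝ × EuclideanSpace ℝ (Fin d) => f p.1 p.2) (t, x) (1, 0)) t := by
  have h2 : HasDerivAt (fun s : ℝ => (s, x)) (1, 0) t :=
    (hasDerivAt_id t).prodMk (hasDerivAt_const t x)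
  exact hf.hasFDerivAt.comp_hasDerivAt t h2

lemma DifferentiableAt.timeDeriv_eq {f : ℝ → EuclideanSpace ℝ (Fin d) → ℝ} {t : ℝ}
    (ht : t ∈ Icc (0 : ℝ) 1) {x : EuclideanSpace ℝ (Fin d)}
    (hf : DifferentiableAt ℝ (fun p : ℝ × EuclideanSpace ℝ (Fin d) => f p.1 p.2) (t, x)) :
    timeDeriv f t x =
      fderiv ℝ (fun p : ℝ × EuclideanSpace ℝ (Fin d) => f p.1 p.2) (t, x) (1, 0) :=
  hf.hasDerivAt_slice.hasDerivWithinAt.derivWithin (uniqueDiffOn_Icc zero_lt_one t ht)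

lemma ContDiffOn.continuousOn_deriv_slice {f : ℝ → EuclideanSpace ℝ (Fin d) → ℝ}
    (hf : ContDiffOn ℝ 1 (fun p : ℝ × EuclideanSpace ℝ (Fin d) => f p.1 p.2)
      (Ioo 0 1 ×ˢ interior Ω)) :
    ContinuousOn (fun p : ℝ × EuclideanSpace ℝ (Fin d) => deriv (fun s => f s p.2) p.1)
      (Ioo 0 1 ×ˢ interior Ω) := by
  have ho : IsOpen (Ioo (0 : ℝ) 1 ×ˢ interior Ω) := isOpen_Ioo.prod isOpen_interior
  refine ((hf.continuousOn_fderiv_of_isOpen ho le_rfl).clm_apply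
    (continuousOn_const (c := ((1 : ℝ), (0 : EuclideanSpace ℝ (Fin d)))))).congr fun p hp => ?_
  exact ((hf.contDiffAt (ho.mem_nhds hp)).differentiableAt one_ne_zero).hasDerivAt_slice.deriv

lemma hasFDerivWithinAt_slice {S : Set ℝ} {A : Set (EuclideanSpace ℝ (Fin d))}
    {f : ℝ → EuclideanSpace ℝ (Fin d) → ℝ} {t : ℝ} (ht : t ∈ S) {x : EuclideanSpace ℝ (Fin d)}
    (hf : DifferentiableWithinAt ℝ (fun p : ℝ × EuclideanSpace ℝ (Fin d) => f p.1 p.2)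
      (S ×ˢ A) (t, x)) :
    HasFDerivWithinAt (f t) ((fderivWithin ℝ
      (fun p : ℝ × EuclideanSpace ℝ (Fin d) => f p.1 p.2) (S ×ˢ A) (t, x)).comp
        (ContinuousLinearMap.inr ℝ ℝ (EuclideanSpace ℝ (Fin d)))) A x :=
  hf.hasFDerivWithinAt.comp x (hasFDerivAt_prodMk_right t x).hasFDerivWithinAt
    fun _ hy => mk_mem_prod ht hy

/-- General `S` and `A` cover both the open cylinder and the closed one. -/
lemma continuousOn_gradientWithin {S : Set ℝ} {A : Set (EuclideanSpace ℝ (Fin d))}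
    (hS : UniqueDiffOn ℝ S) (hA : UniqueDiffOn ℝ A) {f : ℝ → EuclideanSpace ℝ (Fin d) → ℝ}
    (hf : ContDiffOn ℝ 1 (fun p : ℝ × EuclideanSpace ℝ (Fin d) => f p.1 p.2) (S ×ˢ A)) :
    ContinuousOn (fun p : ℝ × EuclideanSpace ℝ (Fin d) => gradientWithin (f p.1) A p.2)
      (S ×ˢ A) := by
  have h1 : ContinuousOn (fun p => (fderivWithin ℝ
      (fun p : ℝ × EuclideanSpace ℝ (Fin d) => f p.1 p.2) (S ×ˢ A) p).comp
        (ContinuousLinearMap.inr ℝ ℝ (EuclideanSpace ℝ (Fin d)))) (S ×ˢ A) :=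
    (hf.continuousOn_fderivWithin (hS.prod hA) le_rfl).clm_comp continuousOn_const
  refine ((InnerProductSpace.toDual ℝ (EuclideanSpace ℝ (Fin d))).symm.continuous.comp_continuousOn
    h1).congr fun p hp => ?_
  have h2 := hasFDerivWithinAt_slice hp.1 (hf.differentiableOn one_ne_zero p hp)
  simp only [gradientWithin, h2.fderivWithin (hA p.2 hp.2), Function.comp_apply]

lemma gradientWithin_eq_gradient {A : Set (EuclideanSpace ℝ (Fin d))}
    {g : EuclideanSpace ℝ (Fin d) → ℝ} {x : EuclideanSpace ℝ (Fin d)} (hx : x ∈ interior A) :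
    gradientWithin g A x = gradient g x := by
  rw [gradientWithin, gradient, fderivWithin_of_mem_nhds (mem_interior_iff_mem_nhds.1 hx)]

lemma inner_gradient (g : EuclideanSpace ℝ (Fin d) → ℝ) (x v : EuclideanSpace ℝ (Fin d)) :
    inner ℝ (gradient g x) v = fderiv ℝ g x v :=
  InnerProductSpace.toDual_symm_apply

/-- The weak gradient of an `H¹` function that is `C¹` in the interior is its gradient. -/
lemma IsH1.ae_eq_gradient (hΩ : IsCompact Ω) (hconv : Convex ℝ Ω)
    {u : EuclideanSpace ℝ (Fin d) → ℝ} {G : EuclideanSpace ℝ (Fin d) → EuclideanSpace ℝ (Fin d)}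
    (h : IsH1 Ω u G) (hu : ContDiffOn ℝ 1 u (interior Ω)) :
    G =ᵐ[volume.restrict Ω] gradient u := by
  have hcont : ContinuousOn (gradient u) (interior Ω) :=
    (InnerProductSpace.toDual ℝ (EuclideanSpace ℝ (Fin d))).symm.continuous.comp_continuousOn
      (hu.continuousOn_fderiv_of_isOpen isOpen_interior le_rfl)
  -- The classical gradient is so far only continuous in the interior, perhaps not integrable up to
  -- the boundary; this is why uniqueness is needed for locally integrable fields.
  refine ae_eq_of_weak_gradient hconv (h.locallyIntegrableOn hΩ)
    (hcont.locallyIntegrableOn isOpen_interior.measurableSet) fun ψ hψ hc hs v => ?_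
  have h1 := h.integral_eq ψ hψ hc hs v
  have h2 := integral_mul_fderiv_eq_neg_of_tsupport_subset (ν := volume) isOpen_interior hu hψ hc
    hs v
  have e1 : ∫ x in Ω, u x * fderiv ℝ ψ x v = ∫ x, u x * fderiv ℝ ψ x v :=
    setIntegral_eq_integral_of_forall_compl_eq_zero fun x hx => by
      have : fderiv ℝ ψ x = 0 := by
        by_contra h0
        exact hx (interior_subset (hs (support_fderiv_subset ℝ h0)))
      simp [this]
  have e2 : ∫ x in Ω, inner ℝ (gradient u x) v * ψ x = ∫ x, fderiv ℝ u x v * ψ x := by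
    rw [setIntegral_eq_integral_of_forall_compl_eq_zero]
    · simp only [inner_gradient]
    · exact fun x hx => mul_eq_zero_of_notMem hs (fun h => hx (interior_subset h)) _
  linarith

variable {α : ℝ} {μ Φ : ℝ → EuclideanSpace ℝ (Fin d) → ℝ} {p : ℝ → SobolevH1 Ω}

lemma IsSolutionCurve.weakGradient_ae_eq (h : IsSolutionCurve Ω α μ Φ p) (hΩ : IsCompact Ω)
    (hconv : Convex ℝ Ω) (hC : ContDiffOn ℝ 1
      (fun p : ℝ × EuclideanSpace ℝ (Fin d) => Φ p.1 p.2) (Ioo 0 1 ×ˢ interior Ω))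
    {t : ℝ} (ht : t ∈ Ioo (0 : ℝ) 1) :
    weakGradient Ω (Φ t) =ᵐ[volume.restrict Ω] gradient (Φ t) := by
  refine (h.isH1 (Ioo_subset_Icc_self ht)).ae_eq_gradient hΩ hconv ?_
  exact hC.comp (f := fun x => (t, x)) (contDiff_prodMk_right t).contDiffOn
    fun x hx => mk_mem_prod ht hx

lemma ae_mem_Ioo_of_mem_uIoc : ∀ᵐ t : ℝ, t ∈ uIoc (0 : ℝ) 1 → t ∈ Ioo (0 : ℝ) 1 := by
  have h1 : ∀ᵐ t : ℝ, t ≠ 1 := by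
    rw [ae_iff]; simp
  filter_upwards [h1] with t ht1 ht
  rw [uIoc_of_le zero_le_one] at ht
  exact ⟨ht.1, lt_of_le_of_ne ht.2 ht1⟩

/-- Integration by parts in the weak Hamilton–Jacobi equation. -/
lemma IsSolutionCurve.weak_residual_eq (h : IsSolutionCurve Ω α μ Φ p) (hΩ : IsCompact Ω)
    (hconv : Convex ℝ Ω) (hC : ContDiffOn ℝ 1
      (fun p : ℝ × EuclideanSpace ℝ (Fin d) => Φ p.1 p.2) (Ioo 0 1 ×ˢ interior Ω))
    {ψ : ℝ × EuclideanSpace ℝ (Fin d) → ℝ} (hψ : ContDiff ℝ ∞ ψ) (hc : HasCompactSupport ψ)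
    (hs : tsupport ψ ⊆ Ioo 0 1 ×ˢ interior Ω) :
    (∫ t in (0 : ℝ)..1, ∫ x in Ω, Φ t x * timeDeriv (fun t x => ψ (t, x)) t x) -
      (∫ t in (0 : ℝ)..1, ∫ x in Ω, (1 / 2) * ‖weakGradient Ω (Φ t) x‖ ^ 2 * ψ (t, x)) =
    -∫ p : ℝ × EuclideanSpace ℝ (Fin d), ψ p • (deriv (fun s => Φ s p.2) p.1 +
      (1 / 2) * ‖gradient (Φ p.1) p.2‖ ^ 2) := by
  have ho : IsOpen (Ioo (0 : ℝ) 1 ×ˢ interior Ω) := isOpen_Ioo.prod isOpen_interior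
  have hd := hC.continuousOn_deriv_slice
  have hg : ContinuousOn (fun p : ℝ × EuclideanSpace ℝ (Fin d) =>
      (1 / 2) * ‖gradient (Φ p.1) p.2‖ ^ 2) (Ioo 0 1 ×ˢ interior Ω) := by
    refine ((((continuousOn_gradientWithin isOpen_Ioo.uniqueDiffOn isOpen_interior.uniqueDiffOn
      hC).congr fun p hp => ?_).norm).pow 2).const_mul (1 / 2)
    exact (gradientWithin_eq_gradient (by rw [interior_interior]; exact hp.2)).symm
  have hi1 := integrable_mul_of_tsupport_subset (ν := volume) hd hψ.continuous hc hs
  have hi2 := integrable_mul_of_tsupport_subset (ν := volume) hg hψ.continuous hc hs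
  have hψ1 : Continuous fun p => fderiv ℝ ψ p (1, 0) :=
    (hψ.continuous_fderiv (by simp)).clm_apply continuous_const
  have hs1 : tsupport (fun p => fderiv ℝ ψ p (1, 0)) ⊆ Ioo 0 1 ×ˢ interior Ω :=
    (tsupport_fderiv_apply_subset ℝ _).trans hs
  have hi3 := integrable_mul_of_tsupport_subset (ν := volume) hC.continuousOn hψ1
    (hc.fderiv_apply ℝ _) hs1
  -- Fubini turns the iterated integral into one over space-time, where integration by parts takes
  -- place in the direction `(1, 0)`.
  have e1 : ∫ t in (0 : ℝ)..1, ∫ x in Ω, Φ t x * timeDeriv (fun t x => ψ (t, x)) t x =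
      -∫ p : ℝ × EuclideanSpace ℝ (Fin d), deriv (fun s => Φ s p.2) p.1 * ψ p := by
    have h1 := integral_integral_eq_integral_prod hi3
      fun p hp => mul_eq_zero_of_notMem hs1 hp _
    have h2 := integral_mul_fderiv_eq_neg_of_tsupport_subset (ν := volume) ho hC hψ hc hs (1, 0)
    rw [h2] at h1
    have h3 : ∫ p : ℝ × EuclideanSpace ℝ (Fin d), fderiv ℝ
        (fun p : ℝ × EuclideanSpace ℝ (Fin d) => Φ p.1 p.2) p (1, 0) * ψ p =
        ∫ p : ℝ × EuclideanSpace ℝ (Fin d), deriv (fun s => Φ s p.2) p.1 * ψ p := by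
      refine integral_congr_ae (Eventually.of_forall fun p => ?_)
      by_cases hp : p ∈ Ioo (0 : ℝ) 1 ×ˢ interior Ω
      · have := ((hC.contDiffAt (ho.mem_nhds hp)).differentiableAt
          one_ne_zero).hasDerivAt_slice.deriv
        simp only [this]
      · exact (mul_eq_zero_of_notMem hs hp _).trans (mul_eq_zero_of_notMem hs hp _).symm
    rw [← h3, ← h1]
    refine intervalIntegral.integral_congr fun t ht => ?_
    rw [uIcc_of_le zero_le_one] at ht
    refine integral_congr_ae (Eventually.of_forall fun x => ?_)
    have := DifferentiableAt.timeDeriv_eq (f := fun t x => ψ (t, x)) ht (x := x)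
      (hψ.differentiable (by simp) (t, x))
    simp only [this]
  have e2 : ∫ t in (0 : ℝ)..1, ∫ x in Ω, (1 / 2) * ‖weakGradient Ω (Φ t) x‖ ^ 2 * ψ (t, x) =
      ∫ p : ℝ × EuclideanSpace ℝ (Fin d), (1 / 2) * ‖gradient (Φ p.1) p.2‖ ^ 2 * ψ p := by
    rw [← integral_integral_eq_integral_prod hi2 fun p hp => mul_eq_zero_of_notMem hs hp _]
    refine intervalIntegral.integral_congr_ae ?_
    filter_upwards [ae_mem_Ioo_of_mem_uIoc] with t ht ht'
    refine integral_congr_ae ?_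
    filter_upwards [h.weakGradient_ae_eq hΩ hconv hC (ht ht')] with x hx
    rw [hx]
  rw [e1, e2, ← neg_add', ← integral_add hi1 hi2]
  congr 1
  refine integral_congr_ae (Eventually.of_forall fun p => ?_)
  simp only [smul_eq_mul]
  ring

/-- After integration by parts the weak equation says that the residual is orthogonal to all test
functions. It therefore vanishes almost everywhere, and by continuity everywhere. -/
lemma IsSolutionCurve.weakHamiltonJacobi_iff (h : IsSolutionCurve Ω α μ Φ p) (hΩ : IsCompact Ω)
    (hconv : Convex ℝ Ω) (hC : ContDiffOn ℝ 1
      (fun p : ℝ × EuclideanSpace ℝ (Fin d) => Φ p.1 p.2) (Ioo 0 1 ×ˢ interior Ω)) :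
    WeakHamiltonJacobi Ω Φ ↔ ∀ t ∈ Ioo (0 : ℝ) 1, ∀ x ∈ interior Ω,
      deriv (fun s => Φ s x) t + (1 / 2) * ‖gradient (Φ t) x‖ ^ 2 = 0 := by
  have ho : IsOpen (Ioo (0 : ℝ) 1 ×ˢ interior Ω) := isOpen_Ioo.prod isOpen_interior
  have hr : ContinuousOn (fun p : ℝ × EuclideanSpace ℝ (Fin d) => deriv (fun s => Φ s p.2) p.1 +
      (1 / 2) * ‖gradient (Φ p.1) p.2‖ ^ 2) (Ioo 0 1 ×ˢ interior Ω) := by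
    refine hC.continuousOn_deriv_slice.add
      (((((continuousOn_gradientWithin isOpen_Ioo.uniqueDiffOn isOpen_interior.uniqueDiffOn
      hC).congr fun p hp => ?_).norm).pow 2).const_mul (1 / 2))
    exact (gradientWithin_eq_gradient (by rw [interior_interior]; exact hp.2)).symm
  constructor
  · intro hw t ht x hx
    have hae := ho.ae_eq_zero_of_integral_contDiff_smul_eq_zero (μ := volume)
      (hr.locallyIntegrableOn ho.measurableSet) fun ψ hψ hc hs => by
        have h1 := h.weak_residual_eq hΩ hconv hC hψ hc hs
        rw [hw (fun t x => ψ (t, x)) hψ hc hs, sub_self] at h1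
        exact neg_eq_zero.1 h1.symm
    have heq := Measure.eqOn_open_of_ae_eq (μ := volume) (g := fun _ => (0 : ℝ))
      ((ae_restrict_iff' ho.measurableSet).2 hae) ho hr continuousOn_const
    exact heq (mk_mem_prod ht hx)
  · intro hp ψ hψ hc hs
    have h1 := h.weak_residual_eq hΩ hconv hC hψ hc hs
    rw [integral_eq_zero_of_ae, neg_zero] at h1
    · exact sub_eq_zero.1 h1
    · refine Eventually.of_forall fun p => ?_
      by_cases hpm : p ∈ Ioo (0 : ℝ) 1 ×ˢ interior Ω
      · simp only [hp p.1 hpm.1 p.2 hpm.2, smul_zero, Pi.zero_apply]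
      · have : ψ p.1 p.2 = 0 := image_eq_zero_of_notMem_tsupport
          (f := fun p : ℝ × EuclideanSpace ℝ (Fin d) => ψ p.1 p.2) fun h => hpm (hs h)
        simp [this]

end HamiltonJacobi

/-! ### The Euler–Lagrange equation and its equivalent forms. -/

section Main

variable {d : ℕ} {Ω : Set (EuclideanSpace ℝ (Fin d))}

/-- The value of the first variation of the energy. -/
def firstVariation (Ω : Set (EuclideanSpace ℝ (Fin d)))
    (Φ η : ℝ → EuclideanSpace ℝ (Fin d) → ℝ) : ℝ :=
  ∫ t in (0 : ℝ)..1, (2 * (∫ x in Ω, Φ t x * timeDeriv η t x) -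
    ∫ x in Ω, ‖weakGradient Ω (Φ t) x‖ ^ 2 * η t x)

variable {α : ℝ} {μ Φ η : ℝ → EuclideanSpace ℝ (Fin d) → ℝ} {p : ℝ → SobolevH1 Ω}

/-- Derivatives are unique, so the condition becomes the vanishing of an explicit linear functional
of `η`. -/
lemma IsPositivePath.eulerLagrange_iff (hμ : IsPositivePath Ω μ) (hΩ : IsCompact Ω)
    (hconv : Convex ℝ Ω) (hne : (interior Ω).Nonempty) (hα : 0 < α)
    (hΦ : ∀ t ∈ Icc (0 : ℝ) 1, IsResolvent Ω α (μ t) (timeDeriv μ t) (Φ t))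
    (h : IsSolutionCurve Ω α μ Φ p) :
    EulerLagrange Ω α μ ↔
      ∀ η, IsPerturbation Ω η → FixesEndpoints Ω η → firstVariation Ω Φ η = 0 := by
  refine forall₃_congr fun η hη _ => ?_
  have hD : HasFirstVariation Ω α μ η (firstVariation Ω Φ η) :=
    h.hasFirstVariation hΩ hconv hne hμ hα hΦ hη
  exact ⟨fun h0 => hD.unique h0, fun h0 => h0 ▸ hD⟩

namespace IsSolutionCurve

lemma firstVariation_eq (h : IsSolutionCurve Ω α μ Φ p) (hΩ : IsCompact Ω)
    (hconv : Convex ℝ Ω) (hne : (interior Ω).Nonempty) (hη : IsPerturbation Ω η) :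
    firstVariation Ω Φ η = ∫ t in (0 : ℝ)..1, ∫ x in Ω,
      (2 * Φ t x * timeDeriv η t x - ‖weakGradient Ω (Φ t) x‖ ^ 2 * η t x) := by
  refine intervalIntegral.integral_congr fun t ht => ?_
  rw [uIcc_of_le zero_le_one] at ht
  have h1 : Integrable (fun x => Φ t x * timeDeriv η t x) (volume.restrict Ω) :=
    IntegrableOn.mul_continuousOn (h.integrable hΩ ht)
      ((hη.contDiffOn_one.continuousOn_timeDeriv hconv hne).slice ht) hΩ
  have h2 : Integrable (fun x => ‖weakGradient Ω (Φ t) x‖ ^ 2 * η t x) (volume.restrict Ω) :=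
    IntegrableOn.mul_continuousOn (h.integrable_sq ht) (hη.continuousOn.slice ht) hΩ
  simp only [mul_assoc]
  rw [integral_sub (h1.const_mul 2) h2, integral_const_mul]

lemma firstVariation_eq_sub (h : IsSolutionCurve Ω α μ Φ p) (hΩ : IsCompact Ω)
    (hconv : Convex ℝ Ω) (hne : (interior Ω).Nonempty) (hη : IsPerturbation Ω η) :
    firstVariation Ω Φ η = 2 * (∫ t in (0 : ℝ)..1, ∫ x in Ω, Φ t x * timeDeriv η t x) -
      ∫ t in (0 : ℝ)..1, ∫ x in Ω, ‖weakGradient Ω (Φ t) x‖ ^ 2 * η t x := by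
  have h1 := h.continuousOn_integral_mul hΩ (hη.contDiffOn_one.continuousOn_timeDeriv hconv hne)
  have h2 := h.continuousOn_integral_sq_mul hΩ hη.continuousOn
  rw [← uIcc_of_le zero_le_one] at h1 h2
  rw [firstVariation, intervalIntegral.integral_sub (h1.intervalIntegrable.const_mul 2)
    h2.intervalIntegrable, intervalIntegral.integral_const_mul]

/-- On test functions the first variation is twice the residual of the weak equation. The remaining
admissible directions are reached by `exists_testFunction_approx` and dominated convergence. -/
lemma weakHamiltonJacobi_iff_firstVariation (h : IsSolutionCurve Ω α μ Φ p) (hΩ : IsCompact Ω)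
    (hconv : Convex ℝ Ω) (hne : (interior Ω).Nonempty) :
    (∀ η, IsPerturbation Ω η → FixesEndpoints Ω η → firstVariation Ω Φ η = 0) ↔
      WeakHamiltonJacobi Ω Φ := by
  have hhalf : ∀ ψ : ℝ → EuclideanSpace ℝ (Fin d) → ℝ,
      ∫ t in (0 : ℝ)..1, ∫ x in Ω, (1 / 2) * ‖weakGradient Ω (Φ t) x‖ ^ 2 * ψ t x =
      (1 / 2) * ∫ t in (0 : ℝ)..1, ∫ x in Ω, ‖weakGradient Ω (Φ t) x‖ ^ 2 * ψ t x := by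
    intro ψ
    simp only [mul_assoc, integral_const_mul, intervalIntegral.integral_const_mul]
  constructor
  · intro hfv ψ hψ hc hs
    have hpert : IsPerturbation Ω ψ := hψ.contDiffOn
    have hend : FixesEndpoints Ω ψ := by
      have h0 : ∀ t x, t ∉ Ioo (0 : ℝ) 1 → ψ t x = 0 := fun t x ht =>
        image_eq_zero_of_notMem_tsupport (x := (t, x))
          (f := fun p : ℝ × EuclideanSpace ℝ (Fin d) => ψ p.1 p.2) fun hp => ht (hs hp).1
      exact fun x _ => ⟨h0 0 x (by simp), h0 1 x (by simp)⟩
    have h1 := hfv ψ hpert hend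
    rw [h.firstVariation_eq_sub hΩ hconv hne hpert] at h1
    rw [hhalf]
    linarith
  · intro hw η hη hend
    obtain ⟨F, C, hF, hC, hlim⟩ := exists_testFunction_approx hΩ hconv hne hη hend
    obtain ⟨K, hK⟩ := h.exists_bound_integral_abs hΩ
    obtain ⟨K', hK'⟩ := h.exists_bound_integral_sq hΩ
    have hFp : ∀ n, IsPerturbation Ω (F n) := fun n => (hF n).1.contDiffOn
    have l1 := tendsto_integral_integral_mul hΩ hconv (fun t ht => h.integrable hΩ ht) hK
      (fun f hf => h.continuousOn_integral_mul hΩ hf)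
      (F := fun n => timeDeriv (F n)) (f := timeDeriv η)
      (fun n => (hFp n).contDiffOn_one.continuousOn_timeDeriv hconv hne)
      (fun n t ht x hx => (hC n t ht x hx).2) (fun t ht x hx => (hlim t ht x hx).2)
    have l2 := tendsto_integral_integral_mul hΩ hconv (fun t ht => h.integrable_sq ht) hK'
      (fun f hf => h.continuousOn_integral_sq_mul hΩ hf) (F := F) (f := η)
      (fun n => (hFp n).continuousOn)
      (fun n t ht x hx => (hC n t ht x hx).1) (fun t ht x hx => (hlim t ht x hx).1)
    rw [h.firstVariation_eq_sub hΩ hconv hne hη]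
    have hzero : ∀ n, 2 * (∫ t in (0 : ℝ)..1, ∫ x in Ω, Φ t x * timeDeriv (F n) t x) -
        ∫ t in (0 : ℝ)..1, ∫ x in Ω, ‖weakGradient Ω (Φ t) x‖ ^ 2 * F n t x = 0 := by
      intro n
      have h1 := hw (F n) (hF n).1 (hF n).2.1 (hF n).2.2
      rw [hhalf] at h1
      linarith
    have l3 := (l1.const_mul 2).sub l2
    simp only [hzero] at l3
    exact tendsto_nhds_unique l3 tendsto_const_nhds

end IsSolutionCurve

lemma integrable_prod_of_continuousOn (hΩ : IsCompact Ω) {k : ℝ → EuclideanSpace ℝ (Fin d) → ℝ}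
    (hk : ContinuousOn (fun p : ℝ × EuclideanSpace ℝ (Fin d) => k p.1 p.2) (Icc 0 1 ×ˢ Ω)) :
    Integrable (Function.uncurry k)
      ((volume.restrict (Ioc (0 : ℝ) 1)).prod (volume.restrict Ω)) := by
  rw [Measure.prod_restrict]
  exact IntegrableOn.mono_set (hk.integrableOn_compact (isCompact_Icc.prod hΩ))
    (prod_mono Ioc_subset_Icc_self subset_rfl)

lemma intervalIntegrable_integral_of_continuousOn (hΩ : IsCompact Ω)
    {k : ℝ → EuclideanSpace ℝ (Fin d) → ℝ}
    (hk : ContinuousOn (fun p : ℝ × EuclideanSpace ℝ (Fin d) => k p.1 p.2) (Icc 0 1 ×ˢ Ω)) :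
    IntervalIntegrable (fun t => ∫ x in Ω, k t x) volume 0 1 := by
  rw [intervalIntegrable_iff_integrableOn_Ioc_of_le zero_le_one]
  exact (integrable_prod_of_continuousOn hΩ hk).integral_prod_left

/-- Integration by parts in time on `[0, 1] × Ω`. -/
lemma integral_integral_mul_timeDeriv (hΩ : IsCompact Ω) (hconv : Convex ℝ Ω)
    (hne : (interior Ω).Nonempty)
    (hΦ : ContDiffOn ℝ 1 (fun p : ℝ × EuclideanSpace ℝ (Fin d) => Φ p.1 p.2) (Icc 0 1 ×ˢ Ω))
    (hη : ContDiffOn ℝ 1 (fun p : ℝ × EuclideanSpace ℝ (Fin d) => η p.1 p.2) (Icc 0 1 ×ˢ Ω))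
    (hend : FixesEndpoints Ω η) :
    ∫ t in (0 : ℝ)..1, ∫ x in Ω, (Φ t x * timeDeriv η t x + timeDeriv Φ t x * η t x) = 0 := by
  have hΦt := hΦ.continuousOn_timeDeriv hconv hne
  have hηt := hη.continuousOn_timeDeriv hconv hne
  have hk : ContinuousOn (fun p : ℝ × EuclideanSpace ℝ (Fin d) =>
      Φ p.1 p.2 * timeDeriv η p.1 p.2 + timeDeriv Φ p.1 p.2 * η p.1 p.2) (Icc 0 1 ×ˢ Ω) :=
    (hΦ.continuousOn.mul hηt).add (hΦt.mul hη.continuousOn)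
  have hint := integrable_prod_of_continuousOn
    (k := fun t x => Φ t x * timeDeriv η t x + timeDeriv Φ t x * η t x) hΩ hk
  -- With the time integral inside, the integrand is `∂ₜ(Φ η)` for fixed `x`, and `Φ η` vanishes at
  -- both ends.
  rw [intervalIntegral.integral_of_le zero_le_one, integral_integral_swap hint]
  refine (setIntegral_congr_fun hΩ.measurableSet fun x hx => ?_).trans (integral_zero _ _)
  have hpath : ContinuousOn (fun t : ℝ => (t, x)) (Icc 0 1) := by fun_prop
  have hmaps : MapsTo (fun t : ℝ => (t, x)) (Icc 0 1) (Icc 0 1 ×ˢ Ω) :=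
    fun t ht => mk_mem_prod ht hx
  have hkx := hk.comp hpath hmaps
  rw [← uIcc_of_le zero_le_one] at hkx
  have hFTC := intervalIntegral.integral_eq_sub_of_hasDerivAt_of_le zero_le_one
    (f := fun t => Φ t x * η t x)
    (f' := fun t => Φ t x * timeDeriv η t x + timeDeriv Φ t x * η t x)
    ((hΦ.continuousOn.mul hη.continuousOn).comp hpath hmaps) (fun t ht => ?_)
    hkx.intervalIntegrable
  · rw [← intervalIntegral.integral_of_le zero_le_one, hFTC, (hend x hx).1, (hend x hx).2]
    simp
  · have ht' := Ioo_subset_Icc_self ht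
    have h1 := hΦ.hasDerivWithinAt_slice ht' hx
    have h2 := hη.hasDerivWithinAt_slice ht' hx
    rw [← hΦ.timeDeriv_eq ht' hx] at h1
    rw [← hη.timeDeriv_eq ht' hx] at h2
    exact ((h1.mul h2).hasDerivAt (Icc_mem_nhds ht.1 ht.2)).congr_deriv (add_comm _ _)

lemma ContDiffOn.mono_interior_cylinder
    (hC : ContDiffOn ℝ 1 (fun p : ℝ × EuclideanSpace ℝ (Fin d) => Φ p.1 p.2) (Icc 0 1 ×ˢ Ω)) :
    ContDiffOn ℝ 1 (fun p : ℝ × EuclideanSpace ℝ (Fin d) => Φ p.1 p.2)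
      (Ioo 0 1 ×ˢ interior Ω) :=
  hC.mono (prod_mono Ioo_subset_Icc_self interior_subset)

/-- The integrand is `2 ∂ₜ(Φ η) - η (2 ∂ₜΦ + ‖∇Φ‖²)` almost everywhere, and the total derivative
integrates to zero. -/
lemma IsSolutionCurve.firstVariation_eq_neg (h : IsSolutionCurve Ω α μ Φ p) (hΩ : IsCompact Ω)
    (hconv : Convex ℝ Ω) (hne : (interior Ω).Nonempty)
    (hC : ContDiffOn ℝ 1 (fun p : ℝ × EuclideanSpace ℝ (Fin d) => Φ p.1 p.2) (Icc 0 1 ×ˢ Ω))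
    (hη : IsPerturbation Ω η) (hend : FixesEndpoints Ω η) :
    firstVariation Ω Φ η = -∫ t in (0 : ℝ)..1, ∫ x in Ω,
      η t x * (2 * timeDeriv Φ t x + ‖gradientWithin (Φ t) Ω x‖ ^ 2) := by
  have hη1 := hη.contDiffOn_one
  have hηc := hη.continuousOn
  have hηt := hη1.continuousOn_timeDeriv hconv hne
  have hΦt := hC.continuousOn_timeDeriv hconv hne
  have hgrad := continuousOn_gradientWithin (uniqueDiffOn_Icc zero_lt_one)
    (uniqueDiffOn_convex hconv hne) hC
  have hT : ContinuousOn (fun p : ℝ × EuclideanSpace ℝ (Fin d) =>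
      η p.1 p.2 * (2 * timeDeriv Φ p.1 p.2 + ‖gradientWithin (Φ p.1) Ω p.2‖ ^ 2))
      (Icc 0 1 ×ˢ Ω) := hηc.mul ((hΦt.const_mul 2).add (hgrad.norm.pow 2))
  have hk : ContinuousOn (fun p : ℝ × EuclideanSpace ℝ (Fin d) =>
      Φ p.1 p.2 * timeDeriv η p.1 p.2 + timeDeriv Φ p.1 p.2 * η p.1 p.2) (Icc 0 1 ×ˢ Ω) :=
    (hC.continuousOn.mul hηt).add (hΦt.mul hηc)
  have hkI := intervalIntegrable_integral_of_continuousOn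
    (k := fun t x => Φ t x * timeDeriv η t x + timeDeriv Φ t x * η t x) hΩ hk
  have hTI := intervalIntegrable_integral_of_continuousOn
    (k := fun t x => η t x * (2 * timeDeriv Φ t x + ‖gradientWithin (Φ t) Ω x‖ ^ 2)) hΩ hT
  have hsplit : firstVariation Ω Φ η = ∫ t in (0 : ℝ)..1,
      (2 * (∫ x in Ω, (Φ t x * timeDeriv η t x + timeDeriv Φ t x * η t x)) -
      ∫ x in Ω, η t x * (2 * timeDeriv Φ t x + ‖gradientWithin (Φ t) Ω x‖ ^ 2)) := by
    rw [h.firstVariation_eq hΩ hconv hne hη]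
    refine intervalIntegral.integral_congr_ae ?_
    filter_upwards [ae_mem_Ioo_of_mem_uIoc] with t ht ht'
    have hto := ht ht'
    have htI := Ioo_subset_Icc_self hto
    have i1 : Integrable (fun x => Φ t x * timeDeriv η t x + timeDeriv Φ t x * η t x)
        (volume.restrict Ω) := (ContinuousOn.slice (f := fun t x =>
          Φ t x * timeDeriv η t x + timeDeriv Φ t x * η t x) hk htI).integrableOn_compact hΩ
    have i2 : Integrable (fun x => η t x * (2 * timeDeriv Φ t x +
        ‖gradientWithin (Φ t) Ω x‖ ^ 2)) (volume.restrict Ω) := (ContinuousOn.slice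
          (f := fun t x => η t x * (2 * timeDeriv Φ t x + ‖gradientWithin (Φ t) Ω x‖ ^ 2))
          hT htI).integrableOn_compact hΩ
    rw [← integral_const_mul, ← integral_sub (i1.const_mul 2) i2]
    refine integral_congr_ae ?_
    have hin : ∀ᵐ x ∂(volume.restrict Ω), gradientWithin (Φ t) Ω x = gradient (Φ t) x :=
      ae_restrict_of_ae_restrict_interior hconv
        (Eventually.of_forall fun x hx => gradientWithin_eq_gradient hx)
    filter_upwards [h.weakGradient_ae_eq hΩ hconv hC.mono_interior_cylinder hto, hin] with x h1 h2
    rw [h1, h2]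
    ring
  rw [hsplit, intervalIntegral.integral_sub (hkI.const_mul 2) hTI,
    intervalIntegral.integral_const_mul,
    integral_integral_mul_timeDeriv hΩ hconv hne hC hη1 hend, mul_zero, zero_sub]

/-- For a `C¹` function the Hamilton–Jacobi equation extends from the interior to the closure. -/
lemma hamiltonJacobi_interior_iff_closed (hΩ : IsCompact Ω) (hconv : Convex ℝ Ω)
    (hne : (interior Ω).Nonempty)
    (hC : ContDiffOn ℝ 1 (fun p : ℝ × EuclideanSpace ℝ (Fin d) => Φ p.1 p.2) (Icc 0 1 ×ˢ Ω)) :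
    (∀ t ∈ Ioo (0 : ℝ) 1, ∀ x ∈ interior Ω,
      deriv (fun s => Φ s x) t + (1 / 2) * ‖gradient (Φ t) x‖ ^ 2 = 0) ↔
    ∀ t ∈ Icc (0 : ℝ) 1, ∀ x ∈ Ω,
      timeDeriv Φ t x + (1 / 2) * ‖gradientWithin (Φ t) Ω x‖ ^ 2 = 0 := by
  have heq : ∀ t ∈ Ioo (0 : ℝ) 1, ∀ x ∈ interior Ω,
      timeDeriv Φ t x + (1 / 2) * ‖gradientWithin (Φ t) Ω x‖ ^ 2 =
      deriv (fun s => Φ s x) t + (1 / 2) * ‖gradient (Φ t) x‖ ^ 2 := by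
    intro t ht x hx
    rw [gradientWithin_eq_gradient hx, timeDeriv, derivWithin_of_mem_nhds (Icc_mem_nhds ht.1 ht.2)]
  constructor
  · intro h t ht x hx
    have hcont : ContinuousOn (fun p : ℝ × EuclideanSpace ℝ (Fin d) =>
        timeDeriv Φ p.1 p.2 + (1 / 2) * ‖gradientWithin (Φ p.1) Ω p.2‖ ^ 2) (Icc 0 1 ×ˢ Ω) :=
      (hC.continuousOn_timeDeriv hconv hne).add (((continuousOn_gradientWithin
        (uniqueDiffOn_Icc zero_lt_one) (uniqueDiffOn_convex hconv hne) hC).norm.pow 2).const_mul _)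
    have hEq : EqOn (fun p : ℝ × EuclideanSpace ℝ (Fin d) =>
        timeDeriv Φ p.1 p.2 + (1 / 2) * ‖gradientWithin (Φ p.1) Ω p.2‖ ^ 2) (fun _ => 0)
        (Ioo 0 1 ×ˢ interior Ω) := fun p hp =>
      (heq p.1 hp.1 p.2 hp.2).trans (h p.1 hp.1 p.2 hp.2)
    -- The open cylinder is dense in the closed one, because a convex set with nonempty interior
    -- lies in the closure of that interior.
    refine hEq.of_subset_closure hcont continuousOn_const
      (prod_mono Ioo_subset_Icc_self interior_subset) ?_ (mk_mem_prod ht hx)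
    rw [closure_prod_eq, closure_Ioo zero_ne_one,
      hconv.closure_interior_eq_closure_of_nonempty_interior hne, hΩ.isClosed.closure_eq]
  · intro h t ht x hx
    rw [← heq t ht x hx]
    exact h t (Ioo_subset_Icc_self ht) x (interior_subset hx)

end Main

end

theorem mainTheorem7 {d : ℕ} (Ω : Set (EuclideanSpace ℝ (Fin d)))
    (hΩ : IsCompact Ω) (hconv : Convex ℝ Ω) (hne : (interior Ω).Nonempty)
    (α : ℝ) (hα : 0 < α)
    (μ : ℝ → EuclideanSpace ℝ (Fin d) → ℝ) (hμ : IsPositivePath Ω μ) :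
    -- the function `(L_μ + α I)⁻¹ ∂ₜμ` is well defined
    (∀ t ∈ Icc (0 : ℝ) 1, ∃ u, IsResolvent Ω α (μ t) (timeDeriv μ t) u ∧
      ∀ w, IsResolvent Ω α (μ t) (timeDeriv μ t) w → w =ᵐ[volume.restrict Ω] u) ∧
    -- for every representative `Φ` of it:
    ∀ Φ : ℝ → EuclideanSpace ℝ (Fin d) → ℝ,
      (∀ t ∈ Icc (0 : ℝ) 1, IsResolvent Ω α (μ t) (timeDeriv μ t) (Φ t)) →
      -- the functional is finite and has a first variation in all smooth directions
      IntervalIntegrable (fun t => ∫ x in Ω, timeDeriv μ t x * Φ t x) volume 0 1 ∧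
      energy Ω α μ = (∫ t in (0 : ℝ)..1, ∫ x in Ω, timeDeriv μ t x * Φ t x) ∧
      (∀ η, IsPerturbation Ω η →
        HasFirstVariation Ω α μ η
          (∫ t in (0 : ℝ)..1, ∫ x in Ω,
            (2 * Φ t x * timeDeriv η t x - ‖weakGradient Ω (Φ t) x‖ ^ 2 * η t x))) ∧
      -- the Euler–Lagrange equation is the Hamilton–Jacobi equation, in the weak sense
      (EulerLagrange Ω α μ ↔ WeakHamiltonJacobi Ω Φ) ∧
      -- ... pointwise in the interior if `Φ` is continuously differentiable there
      (ContDiffOn ℝ 1 (fun p : ℝ × EuclideanSpace ℝ (Fin d) => Φ p.1 p.2)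
          (Ioo 0 1 ×ˢ interior Ω) →
        (EulerLagrange Ω α μ ↔ ∀ t ∈ Ioo (0 : ℝ) 1, ∀ x ∈ interior Ω,
          deriv (fun s => Φ s x) t + (1 / 2) * ‖gradient (Φ t) x‖ ^ 2 = 0)) ∧
      -- ... and pointwise on all of `[0, 1] × Ω` if `Φ` is continuously differentiable there
      (ContDiffOn ℝ 1 (fun p : ℝ × EuclideanSpace ℝ (Fin d) => Φ p.1 p.2) (Icc 0 1 ×ˢ Ω) →
        (∀ η, IsPerturbation Ω η → FixesEndpoints Ω η →
          HasFirstVariation Ω α μ η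
            (-∫ t in (0 : ℝ)..1, ∫ x in Ω,
              η t x * (2 * timeDeriv Φ t x + ‖gradientWithin (Φ t) Ω x‖ ^ 2))) ∧
        (EulerLagrange Ω α μ ↔ ∀ t ∈ Icc (0 : ℝ) 1, ∀ x ∈ Ω,
          timeDeriv Φ t x + (1 / 2) * ‖gradientWithin (Φ t) Ω x‖ ^ 2 = 0)) := by
  refine ⟨fun t ht => hμ.exists_isResolvent hΩ hconv hne hα ht, fun Φ hΦ => ?_⟩
  obtain ⟨p, hp⟩ := exists_isSolutionCurve hΩ hconv hne hμ hα hΦ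
  have hEL := (hμ.eulerLagrange_iff hΩ hconv hne hα hΦ hp).trans
    (hp.weakHamiltonJacobi_iff_firstVariation hΩ hconv hne)
  have hvar : ∀ η, IsPerturbation Ω η → HasFirstVariation Ω α μ η (firstVariation Ω Φ η) :=
    fun η hη => hp.hasFirstVariation hΩ hconv hne hμ hα hΦ hη
  refine ⟨?_, energy_eq_integral hΩ hconv hne hμ hα hΦ, fun η hη => ?_, hEL,
    fun hC => hEL.trans (hp.weakHamiltonJacobi_iff hΩ hconv hC), fun hC => ⟨fun η hη hend => ?_, ?_⟩⟩
  · have h1 := hp.continuousOn_integral_mul hΩ hμ.continuousOn_timeDeriv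
    rw [← uIcc_of_le zero_le_one] at h1
    simpa only [mul_comm] using h1.intervalIntegrable
  · rw [← hp.firstVariation_eq hΩ hconv hne hη]
    exact hvar η hη
  · rw [← hp.firstVariation_eq_neg hΩ hconv hne hC hη hend]
    exact hvar η hη
  · exact (hEL.trans (hp.weakHamiltonJacobi_iff hΩ hconv hC.mono_interior_cylinder)).trans
      (hamiltonJacobi_interior_iff_closed hΩ hconv hne hC)
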